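/- Digraphs are finite and may have loops and multiple arcs. A digraph is eulerian if it is connected and every vertex has indegree equal to outdegree. Circuits are closed trails with at least one arc, taken up to cyclic shift. All embeddings are cellular. An embedding of a digraph is directed if every face is bounded by a directed closed walk. In a directed embedding in an oriented surface, a face is a proface if its facial walk is directed clockwise, and an antiface if it is directed anticlockwise. Two vertices are adjacent in the underlying simple graph of $D$ if they are distinct and joined by an arc of $D$ in some direction. Let $D=(V,A)$ be an $n$-vertex eulerian digraph whose underlying simple graph has minimum degree at least $(4n+2)/5$. Let $\mathcal{C}$ be a set of pairwise arc-disjoint directed circuits in $D$, let $A(\mathcal{C})$ be the set of arcs used by elements of $\mathcal{C}$, and let $\alpha(\mathcal{C})$ be the number of components of $D-A(\mathcal{C})$ with at least one arc. Then there is a directed embedding $\Phi$ of $D$ in an oriented surface such that: 1. every element of $\mathcal{C}$ is a proface of $\Phi$; 2. $\Phi$ has exactly $|\mathcal{C}|+\alpha(\mathcal{C})$ profaces; 3. $\Phi$ has exactly one antiface if $|V|+|A|+|\mathcal{C}|+\alpha(\mathcal{C})$ is odd, and exactly two antifaces if it is even; 4. $\Phi$ has maximum genus among all orientable directed embeddings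 of $D$ in which, for one of the two orientations of the surface, all elements of $\mathcal{C}$ are profaces; 5. if $\alpha(\mathcal{C})\le 1$ (in particular, if $\mathcal{C}$ uses all arcs of $D$), then $\Phi$ has maximum genus among all orientable directed embeddings of $D$ in which all elements of $\mathcal{C}$ are faces. -/

import Mathlib

/-- A directed graph with vertex set `V` and arc set `A`; loops and multiple arcs are allowed. -/
structure MDigraph (V A : Type*) where
  tail : A → V
  head : A → V

namespace MDigraph

variable {V A : Type*}

/-- Half-arcs are the elements of `A ⊕ A`: `Sum.inl a` is the outgoing half-arc of `a`, incident
with the tail of `a`, and `Sum.inr a` is the incoming half-arc of `a`, incident with the head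
of `a`. The mate of a half-arc is given by `Equiv.sumComm A A`. -/
def inc (D : MDigraph V A) : A ⊕ A → V := Sum.elim D.tail D.head

/-- The underlying simple undirected graph. -/
def usg (D : MDigraph V A) : SimpleGraph V :=
  SimpleGraph.fromRel fun u v => ∃ a, D.tail a = u ∧ D.head a = v

/-- A digraph is eulerian if it is connected and every vertex has equal indegree and outdegree. -/
def IsEulerian (D : MDigraph V A) : Prop :=
  D.usg.Connected ∧ ∀ v, {a | D.head a = v}.ncard = {a | D.tail a = v}.ncard

/-- Nontrivial directed circuits (closed directed trails), taken up to cyclic shift: cyclic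
sequences of distinct arcs in which each arc starts where the preceding one ends. -/
def IsCircuit (D : MDigraph V A) (c : Cycle A) : Prop :=
  c ≠ Cycle.nil ∧ c.Nodup ∧ c.Chain fun a b => D.head a = D.tail b

/-- Any two distinct members of `C` have no arc in common. -/
def ArcDisjoint (C : Finset (Cycle A)) : Prop :=
  ∀ c ∈ C, ∀ c' ∈ C, c ≠ c' → ∀ a ∈ c, a ∉ c'

/-- The set of arcs used by the members of `C`. -/
def usedArcs (C : Finset (Cycle A)) : Set A := {a | ∃ c ∈ C, a ∈ c}

/-- The digraph obtained by deleting a set of arcs (and no vertices). -/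
def deleteArcs (D : MDigraph V A) (S : Set A) : MDigraph V {a : A // a ∉ S} where
  tail a := D.tail a
  head a := D.head a

/-- The number of components with at least one arc. -/
noncomputable def numNontrivialComponents (D : MDigraph V A) : ℕ :=
  Nat.card {K : D.usg.ConnectedComponent // ∃ a, D.usg.connectedComponentMk (D.tail a) = K}

/-- The number of components of `D - A(C)` with at least one arc. -/
noncomputable def alpha (D : MDigraph V A) (C : Finset (Cycle A)) : ℕ :=
  (D.deleteArcs (usedArcs C)).numNontrivialComponents

/-- A cellular embedding of a (connected) digraph in an oriented surface, given by its rotation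
system: `rot` sends each half-arc to the next half-arc in clockwise order around its vertex, and it
permutes the half-arcs at each vertex in a single cycle. -/
structure OrientedEmbedding (D : MDigraph V A) where
  rot : Equiv.Perm (A ⊕ A)
  inc_rot : ∀ h, D.inc (rot h) = D.inc h
  sameCycle_rot : ∀ h h', D.inc h = D.inc h' → rot.SameCycle h h'

namespace OrientedEmbedding

variable {D : MDigraph V A} (Φ : D.OrientedEmbedding)

/-- Face tracing. A half-arc `d` stands for the passage from `d` to its mate along the arc.
When a face is traversed clockwise, i.e. with the face on the right, the walk that arrives at a
vertex along a half-arc `h` leaves along the half-arc that precedes `h` in clockwise order. -/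
def faceNext : Equiv.Perm (A ⊕ A) := (Equiv.sumComm A A).trans Φ.rot.symm

/-- The faces are the orbits of face tracing. Each half-arc begins exactly one passage in the
clockwise traversal of exactly one face. -/
def Face : Type _ := Quotient (Equiv.Perm.SameCycle.setoid Φ.faceNext)

/-- The face whose clockwise traversal passes from `d` to its mate. -/
def faceOf (d : A ⊕ A) : Φ.Face := Quotient.mk (Equiv.Perm.SameCycle.setoid Φ.faceNext) d

/-- `w` is the clockwise facial walk of `f`, as a cyclic sequence of passages. -/
def IsFacialWalk (f : Φ.Face) (w : Cycle (A ⊕ A)) : Prop :=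
  w.Nodup ∧ (∀ d, d ∈ w ↔ Φ.faceOf d = f) ∧ w.Chain fun d e => Φ.faceNext d = e

/-- The clockwise facial walk of `f` follows every arc in its direction. -/
def IsProface (f : Φ.Face) : Prop := ∀ d, Φ.faceOf d = f → ∃ a, d = Sum.inl a

/-- The clockwise facial walk of `f` follows every arc against its direction, i.e. the
anticlockwise facial walk of `f` is a directed closed walk. -/
def IsAntiface (f : Φ.Face) : Prop := ∀ d, Φ.faceOf d = f → ∃ a, d = Sum.inr a

/-- A directed embedding: every face is bounded by a directed closed walk. -/
def IsDirected : Prop := ∀ f, Φ.IsProface f ∨ Φ.IsAntiface f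

/-- The cyclic sequence of arcs `c` is the clockwise facial walk of a face. -/
def BoundsProface (c : Cycle A) : Prop := ∃ f, Φ.IsFacialWalk f (c.map Sum.inl)

/-- The cyclic sequence of arcs `c` is the anticlockwise facial walk of a face. -/
def BoundsAntiface (c : Cycle A) : Prop := ∃ f, Φ.IsFacialWalk f (c.map Sum.inr).reverse

noncomputable def numFaces : ℕ := Nat.card Φ.Face

noncomputable def numProfaces : ℕ := Nat.card {f : Φ.Face // Φ.IsProface f}

noncomputable def numAntifaces : ℕ := Nat.card {f : Φ.Face // Φ.IsAntiface f}

/-- The genus `g` of the surface, from Euler's formula `|V| - |A| + |F| = 2 - 2g`. -/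
noncomputable def genus : ℚ :=
  (2 - ((Nat.card V : ℚ) - Nat.card A + Φ.numFaces)) / 2

end OrientedEmbedding

end MDigraph

/-! A directed embedding is encoded by two permutations of the arcs: the cycles of `σ` are the
profaces and those of `τ` the antifaces (`Encodes`). A transition `σ` is completed to an embedding
by any `τ` for which the cycles of `σ⁻¹ * τ` are the fibres of `head` (`Admissible`). The genus
depends only on the number of faces, whose parity is that of |V| + |A|, by comparing signs of
permutations (`even_numFaces_add`). So the theorem needs a `σ` that follows the given circuits with
|C| + α cycles, and then an admissible `τ` with at most two cycles; parity decides between one and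
two.

The first is easy: while two cycles pass through a common vertex along unused arcs, they can be
merged (`exists_isTransition_orbitCount_eq`).

The second is the core. Multiplying `τ` by a suitable three-cycle on arcs with a common head
preserves admissibility. If the arcs lie in three cycles, the count drops by two, so a vertex never
meets three cycles of a minimal `τ`. If two of them lie in one cycle and the third in another, a
part of the former passes to the latter and the count is unchanged (`IsMove`). Among minimal `τ`,
one is chosen that has the largest possible cycle. Interlaced visits of this cycle are excluded,
because moves would bring three cycles to one vertex (`not_linked_word`, `not_linked_twice`).

Suppose that two further cycles meet the largest one, at vertices u and w. Most common neighbours of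
u and w are visited next to u and next to w, in gaps between successive visits. A gap has two ends,
hence holds at most two of them, and adjacent ones must share a gap; this is too sparse for the
degree bound (`false_of_gaps`, `false_of_dense`). So only one further cycle Y meets the largest. If
there were a third cycle, some vertex v of it would be off the largest cycle but have three
neighbours on it, each visited by Y next to v. A move at v separates two of these visits, and then
two further cycles meet the largest, as just excluded.

For optimality, an embedding with all circuits on one side has at least |C| + α + 1 faces, and
parity does the rest. If both sides occur, each side leaves arcs unused by its own circuits, which
gives at least |C| + 2 faces. -/

/-! ### Cycles of a permutation multiplied by a transposition. -/

namespace Equiv.Perm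

variable {α : Type*}

/-- The number of cycles of a permutation, fixed points included. -/
noncomputable def orbitCount (σ : Perm α) : ℕ :=
  Nat.card (Quotient (SameCycle.setoid σ))

/-- A relation that contains every step of `σ` contains its cycles. -/
theorem SameCycle.rel_of_step {σ : Perm α} {R : α → α → Prop} (hR : Equivalence R)
    (h : ∀ a, R a (σ a)) {a b : α} (hab : σ.SameCycle a b) : R a b := by
  obtain ⟨i, rfl⟩ := hab
  have nat : ∀ (n : ℕ) (a : α), R a ((σ ^ n) a) := by
    intro n
    induction n with
    | zero => intro a; exact hR.refl a
    | succ n ih =>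
      intro a
      rw [pow_succ', mul_apply]
      exact hR.trans (ih a) (h _)
  obtain ⟨n, rfl | rfl⟩ := i.eq_nat_or_neg
  · simpa using nat n a
  · have := nat n ((σ ^ (-(n : ℤ))) a)
    rw [← zpow_natCast, ← mul_apply, ← zpow_add, add_neg_cancel, zpow_zero, one_apply] at this
    exact hR.symm this

theorem SameCycle.mem_of_forall_mem [Finite α] {σ : Perm α} {p : α → Prop}
    (h : ∀ a, p a → p (σ a)) {a b : α} (hab : σ.SameCycle a b) (ha : p a) : p b := by
  obtain ⟨i, rfl⟩ := hab.exists_nat_pow_eq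
  clear hab
  induction i with
  | zero => exact ha
  | succ i ih => rw [pow_succ', mul_apply]; exact h _ ih

theorem sameCycle_apply_self (σ : Perm α) (a : α) : σ.SameCycle a (σ a) :=
  sameCycle_apply_right.2 (SameCycle.refl σ a)

variable [DecidableEq α]

section Merge

variable [Finite α] {σ : Perm α} {x y : α}

/-- The product sends `x` to `σ y` and from there runs along the cycle of `y`, which avoids `x`,
until it reaches `y`. -/
theorem sameCycle_mul_swap_of_sameCycle (hxy : ¬ σ.SameCycle x y) {b : α}
    (hb : σ.SameCycle y b) : (σ * swap x y).SameCycle x b := by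
  obtain ⟨i, hi, -, rfl⟩ := hb.exists_pow_eq''
  obtain ⟨k, rfl⟩ : ∃ k, i = k + 1 := ⟨i - 1, by omega⟩
  clear hi hb
  induction k with
  | zero =>
    have := sameCycle_apply_self (σ * swap x y) x
    simpa using this
  | succ k ih =>
    rw [pow_succ', mul_apply]
    by_cases hy : (σ ^ (k + 1)) y = y
    · rw [hy]
      simpa using sameCycle_apply_self (σ * swap x y) x
    · have hx : (σ ^ (k + 1)) y ≠ x := fun h => hxy (SameCycle.symm ⟨(k + 1 : ℕ), by rwa [zpow_natCast]⟩)
      have := sameCycle_apply_self (σ * swap x y) ((σ ^ (k + 1)) y)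
      rw [mul_apply, swap_apply_of_ne_of_ne hx hy] at this
      exact ih.trans this

theorem sameCycle_mul_swap_iff (hxy : ¬ σ.SameCycle x y) (a b : α) :
    (σ * swap x y).SameCycle a b ↔ σ.SameCycle a b ∨
      (σ.SameCycle x a ∧ σ.SameCycle y b) ∨ (σ.SameCycle y a ∧ σ.SameCycle x b) := by
  constructor
  · intro h
    let R : α → α → Prop := fun a b => σ.SameCycle a b ∨
      (σ.SameCycle x a ∧ σ.SameCycle y b) ∨ (σ.SameCycle y a ∧ σ.SameCycle x b)
    have hR : Equivalence R := by
      refine ⟨fun a => Or.inl (SameCycle.refl _ a), ?_, ?_⟩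
      · rintro a b (h | ⟨h, h'⟩ | ⟨h, h'⟩)
        · exact Or.inl h.symm
        · exact Or.inr (Or.inr ⟨h', h⟩)
        · exact Or.inr (Or.inl ⟨h', h⟩)
      · rintro a b c (h | ⟨h, h'⟩ | ⟨h, h'⟩) (k | ⟨k, k'⟩ | ⟨k, k'⟩)
        · exact Or.inl (h.trans k)
        · exact Or.inr (Or.inl ⟨k.trans h.symm, k'⟩)
        · exact Or.inr (Or.inr ⟨k.trans h.symm, k'⟩)
        · exact Or.inr (Or.inl ⟨h, h'.trans k⟩)
        · exact absurd (k.trans h'.symm) hxy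
        · exact Or.inl (h.symm.trans k')
        · exact Or.inr (Or.inr ⟨h, h'.trans k⟩)
        · exact Or.inl (h.symm.trans k')
        · exact absurd (h'.trans k.symm) hxy
    refine h.rel_of_step hR fun a => ?_
    by_cases hax : a = x
    · subst hax
      right; left
      exact ⟨SameCycle.refl _ _, by simpa using sameCycle_apply_self σ y⟩
    by_cases hay : a = y
    · subst hay
      right; right
      exact ⟨SameCycle.refl _ _, by simpa using sameCycle_apply_self σ x⟩
    · left
      rw [mul_apply, swap_apply_of_ne_of_ne hax hay]
      exact sameCycle_apply_self σ a
  · have hyx : ¬ σ.SameCycle y x := fun h => hxy h.symm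
    have key1 : ∀ b, σ.SameCycle y b → (σ * swap x y).SameCycle x b :=
      fun b hb => sameCycle_mul_swap_of_sameCycle hxy hb
    have key2 : ∀ b, σ.SameCycle x b → (σ * swap x y).SameCycle y b := by
      intro b hb
      rw [swap_comm]
      exact sameCycle_mul_swap_of_sameCycle hyx hb
    have hxy' := key1 y (SameCycle.refl _ _)
    rintro (h | ⟨h, h'⟩ | ⟨h, h'⟩)
    · by_cases hx : σ.SameCycle x a
      · exact (key2 a hx).symm.trans (key2 b (hx.trans h))
      by_cases hy : σ.SameCycle y a
      · exact (key1 a hy).symm.trans (key1 b (hy.trans h))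
      obtain ⟨i, rfl⟩ := h.exists_nat_pow_eq
      clear h
      induction i with
      | zero => exact SameCycle.refl _ _
      | succ i ih =>
        have hx' : (σ ^ i) a ≠ x := by
          rintro rfl; exact hx (sameCycle_pow_left.2 (SameCycle.refl _ _))
        have hy' : (σ ^ i) a ≠ y := by
          rintro rfl; exact hy (sameCycle_pow_left.2 (SameCycle.refl _ _))
        have := sameCycle_apply_self (σ * swap x y) ((σ ^ i) a)
        rw [mul_apply, swap_apply_of_ne_of_ne hx' hy'] at this
        rw [pow_succ', mul_apply]
        exact ih.trans this
    · exact (key2 a h).symm.trans (hxy'.symm.trans (key1 b h'))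
    · exact (key1 a h).symm.trans (hxy'.trans (key2 b h'))

/-- Once the class of `y` is left out, the remaining classes of `σ` correspond bijectively to those
of the product, since the class of `x` absorbs that of `y`. -/
theorem orbitCount_mul_swap_add_one (hxy : ¬ σ.SameCycle x y) :
    (σ * swap x y).orbitCount + 1 = σ.orbitCount := by
  classical
  have : Finite (Quotient (SameCycle.setoid σ)) := inferInstance
  let f : {q : Quotient (SameCycle.setoid σ) // q ≠ Quotient.mk _ y} →
      Quotient (SameCycle.setoid (σ * swap x y)) := fun q =>
    Quotient.map' id (fun a b h => (sameCycle_mul_swap_iff hxy a b).2 (Or.inl h)) q.1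
  have hf : Function.Bijective f := by
    constructor
    · rintro ⟨q, hq⟩ ⟨r, hr⟩ h
      induction q using Quotient.inductionOn with | _ a
      induction r using Quotient.inductionOn with | _ b
      have hab : (σ * swap x y).SameCycle a b := Quotient.exact h
      have ha : ¬ σ.SameCycle y a := fun h => hq (Quotient.sound h.symm)
      have hb : ¬ σ.SameCycle y b := fun h => hr (Quotient.sound h.symm)
      have : σ.SameCycle a b := by
        rcases (sameCycle_mul_swap_iff hxy a b).1 hab with h | h | h
        · exact h
        · exact absurd h.2 hb
        · exact absurd h.1 ha
      exact Subtype.ext (Quotient.sound this)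
    · intro r
      induction r using Quotient.inductionOn with | _ b
      by_cases hb : σ.SameCycle y b
      · refine ⟨⟨Quotient.mk _ x, fun h => hxy (Quotient.exact h)⟩, Quotient.sound ?_⟩
        exact sameCycle_mul_swap_of_sameCycle hxy hb
      · exact ⟨⟨Quotient.mk _ b, fun h => hb (SameCycle.symm (Quotient.exact h))⟩, rfl⟩
  have h1 := Nat.card_congr (Equiv.ofBijective f hf)
  unfold orbitCount
  rw [← h1]
  have := Fintype.ofFinite (Quotient (SameCycle.setoid σ))
  rw [Nat.card_eq_fintype_card, Nat.card_eq_fintype_card, Fintype.card_subtype_compl,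
    Fintype.card_subtype_eq]
  have : 0 < Fintype.card (Quotient (SameCycle.setoid σ)) :=
    Fintype.card_pos_iff.2 ⟨Quotient.mk _ x⟩
  omega

/-- Multiplying by a transposition of two elements of one cycle splits that cycle. -/
theorem not_sameCycle_mul_swap (hne : x ≠ y) (hxy : σ.SameCycle x y) :
    ¬ (σ * swap x y).SameCycle x y := by
  classical
  -- the elements met after `x` and up to the first visit to `y` form an invariant set
  obtain ⟨n, hn⟩ := hxy.exists_nat_pow_eq
  let P : ℕ → Prop := fun n => (σ ^ n) x = y
  have hP : ∃ n, P n := ⟨n, hn⟩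
  set N := Nat.find hP with hN
  have hNy : (σ ^ N) x = y := Nat.find_spec hP
  have hmin : ∀ k < N, (σ ^ k) x ≠ y := fun k hk => Nat.find_min hP hk
  have hNpos : 0 < N := by
    rcases Nat.eq_zero_or_pos N with h | h
    · rw [h] at hNy; exact absurd hNy hne
    · exact h
  let S : Set α := {a | ∃ k, 0 < k ∧ k ≤ N ∧ (σ ^ k) x = a}
  have hxS : x ∉ S := by
    rintro ⟨k, hk0, hkN, hk⟩
    have hk' : k ≠ N := by rintro rfl; exact hne (hk.symm.trans hNy)
    have hlt : N - k < N := by omega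
    apply hmin _ hlt
    have : (σ ^ N) x = (σ ^ (N - k)) ((σ ^ k) x) := by
      rw [← mul_apply, ← pow_add]; congr 2; omega
    rw [hk] at this
    rw [← this, hNy]
  have hyS : y ∈ S := ⟨N, hNpos, le_rfl, hNy⟩
  have hfwd : ∀ a ∈ S, (σ * swap x y) a ∈ S := by
    rintro a ⟨k, hk0, hkN, rfl⟩
    rcases hkN.lt_or_eq with hlt | rfl
    · have hx' : (σ ^ k) x ≠ x := fun h => hxS ⟨k, hk0, hkN, h⟩
      rw [mul_apply, swap_apply_of_ne_of_ne hx' (hmin k hlt), ← mul_apply, ← pow_succ']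
      exact ⟨k + 1, by omega, hlt, rfl⟩
    · rw [hNy, mul_apply, swap_apply_right]
      exact ⟨1, one_pos, hNpos, by simp⟩
  intro h
  exact hxS (h.symm.mem_of_forall_mem (p := (· ∈ S)) hfwd hyS)

/-- A second multiplication by the same transposition undoes the split, so this is the merging count
read backwards. -/
theorem orbitCount_mul_swap_of_sameCycle (hne : x ≠ y) (hxy : σ.SameCycle x y) :
    (σ * swap x y).orbitCount = σ.orbitCount + 1 := by
  have := orbitCount_mul_swap_add_one (not_sameCycle_mul_swap hne hxy)
  rw [mul_assoc, swap_mul_self, mul_one] at this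
  exact this.symm

/-- Splitting a cycle refines the partition into cycles. -/
theorem SameCycle.of_mul_swap (hxy : σ.SameCycle x y) {a b : α}
    (h : (σ * swap x y).SameCycle a b) : σ.SameCycle a b := by
  rcases eq_or_ne x y with rfl | hne
  · rwa [swap_self, ← one_def, mul_one] at h
  · have := (sameCycle_mul_swap_iff (not_sameCycle_mul_swap hne hxy) a b).2 (Or.inl h)
    rwa [mul_assoc, swap_mul_self, mul_one] at this

/-- After a split every element of the split cycle is in one of its two parts. -/
theorem SameCycle.mul_swap_left_or_right (hxy : σ.SameCycle x y) {a : α}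
    (h : σ.SameCycle x a) :
    (σ * swap x y).SameCycle x a ∨ (σ * swap x y).SameCycle y a := by
  rcases eq_or_ne x y with rfl | hne
  · left; rwa [swap_self, ← one_def, mul_one]
  · have key := sameCycle_mul_swap_iff (not_sameCycle_mul_swap hne hxy) x a
    rw [mul_assoc, swap_mul_self, mul_one] at key
    rcases key.1 h with h | h | h
    · exact Or.inl h
    · exact Or.inr h.2
    · exact Or.inl h.2

theorem sameCycle_mul_swap_iff_of_not (hxy : σ.SameCycle x y) {a : α} (ha : ¬ σ.SameCycle x a)
    (b : α) : (σ * swap x y).SameCycle a b ↔ σ.SameCycle a b := by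
  rcases eq_or_ne x y with rfl | hne
  · rw [swap_self, ← one_def, mul_one]
  · refine ⟨SameCycle.of_mul_swap hxy, fun h => ?_⟩
    have key := sameCycle_mul_swap_iff (not_sameCycle_mul_swap hne hxy) a b
    rw [mul_assoc, swap_mul_self, mul_one] at key
    rcases key.1 h with h | h | h
    · exact h
    · exact absurd (SameCycle.of_mul_swap hxy h.1) ha
    · exact absurd (hxy.trans (SameCycle.of_mul_swap hxy h.1)) ha

end Merge

/-- A transposition changes the number of cycles by exactly one, so both sides change sign together.
-/
theorem sign_eq_neg_one_pow [Fintype α] (σ : Perm α) :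
    sign σ = (-1) ^ (Fintype.card α + σ.orbitCount) := by
  induction σ using swap_induction_on' with
  | one =>
    have h : (1 : Perm α).orbitCount = Fintype.card α := by
      rw [← Nat.card_eq_fintype_card]
      refine (Nat.card_congr (Equiv.ofBijective (fun a => Quotient.mk _ a) ⟨?_, ?_⟩)).symm
      · intro a b h
        exact sameCycle_one.1 (Quotient.exact h)
      · exact Quotient.mk_surjective
    rw [h, ← two_mul, pow_mul]
    simp
  | mul_swap σ x y hne ih =>
    rw [map_mul, sign_swap hne, ih]
    by_cases hxy : σ.SameCycle x y
    · rw [orbitCount_mul_swap_of_sameCycle hne hxy, ← add_assoc, pow_succ]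
    · rw [← orbitCount_mul_swap_add_one hxy, ← add_assoc, pow_succ, mul_assoc]
      simp

end Equiv.Perm

open Equiv Equiv.Perm

/-! ### Admissible permutations, minimality and moves. -/

namespace DirectedRotation

variable {A V : Type*}

/-- The permutation `τ` is the antiface permutation of a rotation system compatible with the
proface permutation `c`: the cycles of `c⁻¹ * τ` are the fibres of `head`. -/
def Admissible (head : A → V) (c τ : Perm A) : Prop :=
  ∀ a b, (c⁻¹ * τ).SameCycle a b ↔ head a = head b

/-- An admissible permutation with the fewest cycles. -/
def Minimal (head : A → V) (c τ : Perm A) : Prop :=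
  Admissible head c τ ∧ ∀ τ', Admissible head c τ' → τ.orbitCount ≤ τ'.orbitCount

/-- A nonempty set of permutations has a member with the fewest cycles. -/
theorem exists_min_orbitCount {S : Perm A → Prop} (h : ∃ σ, S σ) :
    ∃ σ, S σ ∧ ∀ σ', S σ' → σ.orbitCount ≤ σ'.orbitCount := by
  classical
  have h' : ∃ n, ∃ σ, S σ ∧ σ.orbitCount = n := by
    obtain ⟨σ, hσ⟩ := h
    exact ⟨_, σ, hσ, rfl⟩
  obtain ⟨σ, hσ, hn⟩ := Nat.find_spec h'
  refine ⟨σ, hσ, fun σ' h2 => ?_⟩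
  rw [hn]
  exact Nat.find_min' h' ⟨σ', h2, rfl⟩

variable {head : A → V} {c τ : Perm A}

theorem Admissible.head_apply (h : Admissible head c τ) (a : A) :
    head (c⁻¹ (τ a)) = head a :=
  ((h a _).1 (sameCycle_apply_self _ a)).symm

variable [Finite A]

/-- Among the permutations preserving `head`, one with the fewest cycles is transitive on each
fibre, because two cycles over one vertex could be merged. -/
theorem exists_admissible (head : A → V) (c : Perm A) : ∃ τ, Admissible head c τ := by
  classical
  obtain ⟨ρ, hρ, hmin⟩ := exists_min_orbitCount (S := fun ρ : Perm A => ∀ a, head (ρ a) = head a)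
    ⟨1, fun _ => rfl⟩
  refine ⟨c * ρ, fun a b => ?_⟩
  rw [inv_mul_cancel_left]
  constructor
  · intro h
    exact h.rel_of_step (R := fun a b => head a = head b) ⟨fun _ => rfl, Eq.symm, Eq.trans⟩
      fun a => (hρ a).symm
  · intro h
    by_contra hab
    have h1 := orbitCount_mul_swap_add_one hab
    have h2 := hmin (ρ * swap a b) fun e => by
      rw [mul_apply, hρ]
      rcases eq_or_ne e a with rfl | hea
      · rw [swap_apply_left, h]
      rcases eq_or_ne e b with rfl | heb
      · rw [swap_apply_right, h]
      · rw [swap_apply_of_ne_of_ne hea heb]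
    omega

theorem exists_minimal (head : A → V) (c : Perm A) : ∃ τ, Minimal head c τ :=
  exists_min_orbitCount (exists_admissible head c)

/-- The cycle of `b` is as large as possible in a minimal permutation. -/
def Optimal (head : A → V) (c τ : Perm A) (b : A) : Prop :=
  Minimal head c τ ∧ ∀ τ' b', Minimal head c τ' →
    {a | τ'.SameCycle b' a}.ncard ≤ {a | τ.SameCycle b a}.ncard

theorem exists_optimal [Nonempty A] (head : A → V) (c : Perm A) :
    ∃ τ b, Optimal head c τ b := by
  obtain ⟨τ₀, h₀⟩ := exists_minimal head c
  let S : Set (Perm A × A) := {s | Minimal head c s.1}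
  have hS : S.Finite := Set.toFinite S
  obtain ⟨s, hs, hmax⟩ := S.exists_max_image (fun s => {a | s.1.SameCycle s.2 a}.ncard) hS
    ⟨(τ₀, Classical.arbitrary A), h₀⟩
  exact ⟨s.1, s.2, hs, fun τ' b' h' => hmax (τ', b') h'⟩

variable [DecidableEq A]

/-- One of the two orientations of a three-cycle keeps every rotation a single cycle. -/
theorem Admissible.mul_swap_mul_swap (h : Admissible head c τ) {x y y' : A}
    (hy : head y = head y') (hx : head x = head y) (hne : y ≠ y') :
    ∃ y₀, (y₀ = y ∨ y₀ = y') ∧ Admissible head c (τ * swap y y' * swap x y₀) := by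
  have hyy := (h y y').2 hy
  have hns := not_sameCycle_mul_swap hne hyy
  have key := sameCycle_mul_swap_iff hns
  rw [mul_assoc, swap_mul_self, mul_one] at key
  rcases hyy.mul_swap_left_or_right ((h y x).2 hx.symm) with h1 | h1
  · refine ⟨y', Or.inr rfl, fun a b => ?_⟩
    have hxy : ¬ (c⁻¹ * τ * swap y y').SameCycle x y' := fun h2 => hns (h1.trans h2)
    rw [← h a b, key, ← mul_assoc, ← mul_assoc, sameCycle_mul_swap_iff hxy]
    have e : ∀ e, (c⁻¹ * τ * swap y y').SameCycle x e ↔ (c⁻¹ * τ * swap y y').SameCycle y e :=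
      fun e => ⟨fun h2 => h1.trans h2, fun h2 => h1.symm.trans h2⟩
    rw [e, e]
  · refine ⟨y, Or.inl rfl, fun a b => ?_⟩
    have hxy : ¬ (c⁻¹ * τ * swap y y').SameCycle x y := fun h2 => hns (h1.trans h2).symm
    rw [← h a b, key, ← mul_assoc, ← mul_assoc, sameCycle_mul_swap_iff hxy]
    have e : ∀ e, (c⁻¹ * τ * swap y y').SameCycle x e ↔ (c⁻¹ * τ * swap y y').SameCycle y' e :=
      fun e => ⟨fun h2 => h1.trans h2, fun h2 => h1.symm.trans h2⟩
    rw [e, e]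
    tauto

/-- No vertex meets three different cycles of a minimal permutation. -/
theorem Minimal.not_three (h : Minimal head c τ) {x y z : A} (hxy : ¬ τ.SameCycle x y)
    (hxz : ¬ τ.SameCycle x z) (hyz : ¬ τ.SameCycle y z) (h1 : head x = head y)
    (h2 : head z = head x) : False := by
  have hne : x ≠ y := by rintro rfl; exact hxy (SameCycle.refl _ _)
  -- The three-cycle on `x`, `y`, `z` merges their three cycles into one and lowers the count by
  -- two.
  obtain ⟨x₀, hx₀, hadm⟩ := h.1.mul_swap_mul_swap h1 h2 hne
  have c1 := orbitCount_mul_swap_add_one hxy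
  have hz : ¬ (τ * swap x y).SameCycle z x₀ := by
    rw [sameCycle_mul_swap_iff hxy]
    rcases hx₀ with rfl | rfl
    · rintro (h | h | h)
      · exact hxz h.symm
      · exact hxz h.1
      · exact hyz h.1
    · rintro (h | h | h)
      · exact hyz h.symm
      · exact hxz h.1
      · exact hyz h.1
  have c2 := orbitCount_mul_swap_add_one hz
  have := h.2 _ hadm
  omega

/-- Moving a segment between `y` and `y'` of one cycle into the cycle of `x`. -/
structure IsMove (τ τ' : Perm A) (x y y' : A) : Prop where
  orbitCount_eq : τ'.orbitCount = τ.orbitCount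
  exists_swap : ∃ y₀, (y₀ = y ∨ y₀ = y') ∧ τ' = τ * swap y y' * swap x y₀
  ne : y ≠ y'
  sameCycle : τ.SameCycle y y'
  not_sameCycle : ¬ τ.SameCycle x y

/-- The three-cycle performs one split and one merge, so the count, and with it minimality, is
preserved. -/
theorem Minimal.exists_move (h : Minimal head c τ) {x y y' : A} (hy : head y = head y')
    (hx : head x = head y) (hne : y ≠ y') (hs : τ.SameCycle y y') (hxy : ¬ τ.SameCycle x y) :
    ∃ τ', Minimal head c τ' ∧ IsMove τ τ' x y y' := by
  obtain ⟨y₀, hy₀, hadm⟩ := h.1.mul_swap_mul_swap hy hx hne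
  have hn : ¬ (τ * swap y y').SameCycle x y₀ := by
    intro h'
    have := SameCycle.of_mul_swap hs h'
    rcases hy₀ with rfl | rfl
    · exact hxy this
    · exact hxy (this.trans hs.symm)
  have e : (τ * swap y y' * swap x y₀).orbitCount = τ.orbitCount := by
    have h1 := orbitCount_mul_swap_add_one hn
    have h2 := orbitCount_mul_swap_of_sameCycle hne hs
    omega
  exact ⟨_, ⟨hadm, fun τ' h' => e ▸ h.2 τ' h'⟩, e, ⟨y₀, hy₀, rfl⟩, hne, hs, hxy⟩

namespace IsMove

variable {τ' : Perm A} {x y y' : A}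

/-- The part of the split cycle that contains `y₀` is the one that joins the cycle of `x`. -/
theorem sameCycle_iff (h : IsMove τ τ' x y y') : ∃ y₀, (y₀ = y ∨ y₀ = y') ∧ ∀ a b,
    τ'.SameCycle a b ↔ (τ * swap y y').SameCycle a b ∨
      (τ.SameCycle x a ∧ (τ * swap y y').SameCycle y₀ b) ∨
      ((τ * swap y y').SameCycle y₀ a ∧ τ.SameCycle x b) := by
  obtain ⟨y₀, hy₀, rfl⟩ := h.exists_swap
  refine ⟨y₀, hy₀, fun a b => ?_⟩
  have hyx : ¬ τ.SameCycle y x := fun h' => h.not_sameCycle h'.symm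
  have hn : ¬ (τ * swap y y').SameCycle x y₀ := by
    rw [sameCycle_mul_swap_iff_of_not h.sameCycle hyx]
    rcases hy₀ with rfl | rfl
    · exact h.not_sameCycle
    · exact fun h' => h.not_sameCycle (h'.trans h.sameCycle.symm)
  rw [sameCycle_mul_swap_iff hn, sameCycle_mul_swap_iff_of_not h.sameCycle hyx,
    sameCycle_mul_swap_iff_of_not h.sameCycle hyx]

/-- Cycles that take no part in a move are unchanged. -/
theorem sameCycle_iff_of_not (h : IsMove τ τ' x y y') {a : A} (hx : ¬ τ.SameCycle x a)
    (hy : ¬ τ.SameCycle y a) (b : A) : τ'.SameCycle a b ↔ τ.SameCycle a b := by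
  obtain ⟨y₀, hy₀, key⟩ := h.sameCycle_iff
  rw [key, sameCycle_mul_swap_iff_of_not h.sameCycle hy]
  constructor
  · rintro (h' | h' | h')
    · exact h'
    · exact absurd h'.1 hx
    · refine absurd (SameCycle.of_mul_swap h.sameCycle h'.1) ?_
      rcases hy₀ with rfl | rfl
      · exact hy
      · exact fun h2 => hy (h.sameCycle.trans h2)
  · exact Or.inl

/-- Within the split cycle, a move separates exactly what the split separates. -/
theorem sameCycle_iff_of_sameCycle (h : IsMove τ τ' x y y') {a b : A} (ha : τ.SameCycle y a)
    (hb : τ.SameCycle y b) : τ'.SameCycle a b ↔ (τ * swap y y').SameCycle a b := by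
  obtain ⟨y₀, hy₀, key⟩ := h.sameCycle_iff
  rw [key]
  constructor
  · rintro (h' | h' | h')
    · exact h'
    · exact absurd (h'.1.trans ha.symm) h.not_sameCycle
    · exact absurd (h'.2.trans hb.symm) h.not_sameCycle
  · exact Or.inl

/-- The cycle of `x` grows. -/
theorem sameCycle_of_sameCycle (h : IsMove τ τ' x y y') {a : A} (ha : τ.SameCycle x a) :
    τ'.SameCycle x a := by
  obtain ⟨y₀, hy₀, key⟩ := h.sameCycle_iff
  rw [key]
  left
  exact (sameCycle_mul_swap_iff_of_not h.sameCycle (fun h' => h.not_sameCycle h'.symm) a).2 ha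

theorem exists_sameCycle (h : IsMove τ τ' x y y') :
    ∃ y₀, (y₀ = y ∨ y₀ = y') ∧ τ'.SameCycle x y₀ := by
  obtain ⟨y₀, hy₀, key⟩ := h.sameCycle_iff
  exact ⟨y₀, hy₀, (key _ _).2 (Or.inr (Or.inl ⟨SameCycle.refl _ _, SameCycle.refl _ _⟩))⟩

end IsMove

/-- In a minimal permutation, two elements `y, y'` of one cycle at a vertex that meets another
cycle do not separate two elements at a vertex that meets a third cycle. -/
theorem Minimal.not_linked (h : Minimal head c τ) {x y y' p q z : A} (hy : head y = head y')
    (hx : head x = head y) (hs : τ.SameCycle y y') (hxy : ¬ τ.SameCycle x y)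
    (hyp : τ.SameCycle y p) (hyq : τ.SameCycle y q) (hpq : head p = head q)
    (hz : head z = head p) (hzy : ¬ τ.SameCycle y z) (hzx : ¬ τ.SameCycle x z) :
    (τ * swap y y').SameCycle p q := by
  by_contra hcon
  have hne : y ≠ y' := by
    rintro rfl
    rw [swap_self, ← Perm.one_def, mul_one] at hcon
    exact hcon (hyp.symm.trans hyq)
  obtain ⟨τ', hmin, hm⟩ := h.exists_move hy hx hne hs hxy
  -- After the move `p` and `q` are in different cycles and `z` is in a third, all at one vertex.
  refine hmin.not_three (x := p) (y := q) (z := z) ?_ ?_ ?_ hpq hz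
  · rwa [hm.sameCycle_iff_of_sameCycle hyp hyq]
  · rw [sameCycle_comm, hm.sameCycle_iff_of_not hzx hzy]
    exact fun h' => hzy (hyp.trans h'.symm)
  · rw [sameCycle_comm, hm.sameCycle_iff_of_not hzx hzy]
    exact fun h' => hzy (hyq.trans h'.symm)

variable {b : A}

/-- A vertex on the largest cycle is met at most once by other cycles. -/
theorem Optimal.eq_of_head_eq (h : Optimal head c τ b) {x y z : A} (hz : τ.SameCycle b z)
    (hx : ¬ τ.SameCycle b x) (hy : ¬ τ.SameCycle b y) (hxy : head x = head y)
    (hzx : head z = head x) : x = y := by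
  by_contra hne
  by_cases hs : τ.SameCycle x y
  -- A move at this vertex would pass a part of the cycle of `x` to the largest cycle.
  · have hzx' : ¬ τ.SameCycle z x := fun h' => hx (hz.trans h')
    obtain ⟨τ', hmin, hm⟩ := h.1.exists_move hxy hzx hne hs hzx'
    have hle := h.2 τ' z hmin
    obtain ⟨x₀, hx₀, h'⟩ := hm.exists_sameCycle
    have hlt : {a | τ.SameCycle b a}.ncard < {a | τ'.SameCycle z a}.ncard := by
      refine Set.ncard_lt_ncard ((Set.ssubset_iff_of_subset ?_).2 ⟨x₀, h', ?_⟩) (Set.toFinite _)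
      · exact fun a (ha : τ.SameCycle b a) => hm.sameCycle_of_sameCycle (hz.symm.trans ha)
      · rcases hx₀ with rfl | rfl
        · exact hx
        · exact hy
    omega
  · exact h.1.not_three (x := x) (y := y) (z := z) hs (fun h' => hx (hz.trans h'.symm))
      (fun h' => hy (hz.trans h'.symm)) hxy hzx

/-- The move does not touch the cycle of `b`, which therefore keeps its maximum size. -/
theorem Optimal.of_move (h : Optimal head c τ b) {τ' : Perm A} {x y y' : A}
    (hmin : Minimal head c τ') (hm : IsMove τ τ' x y y') (hx : ¬ τ.SameCycle b x)
    (hy : ¬ τ.SameCycle b y) : Optimal head c τ' b := by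
  refine ⟨hmin, fun τ'' b' h' => ?_⟩
  have e : ∀ a, τ'.SameCycle b a ↔ τ.SameCycle b a := fun a =>
    hm.sameCycle_iff_of_not (fun h => hx h.symm) (fun h => hy h.symm) a
  simp only [e]
  exact h.2 τ'' b' h'

end DirectedRotation

/-! ### Positions on a cycle and forbidden interlacings. -/

namespace DirectedRotation

variable {A V : Type*}

/-- The cycle of `b` has length `l`, so `b, τ b, …, τ ^ (l - 1) b` lists it once. -/
structure IsWord (τ : Perm A) (b : A) (l : ℕ) : Prop where
  pos : 0 < l
  period : (τ ^ l) b = b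
  inj : ∀ i < l, ∀ j < l, (τ ^ i) b = (τ ^ j) b → i = j
  surj : ∀ a, τ.SameCycle b a → ∃ i < l, (τ ^ i) b = a

theorem exists_isWord [Finite A] (τ : Perm A) (b : A) : ∃ l, IsWord τ b l := by
  have hp : 0 < Function.minimalPeriod τ b := by
    apply Function.minimalPeriod_pos_of_mem_periodicPts
    exact τ.injective.mem_periodicPts b
  refine ⟨Function.minimalPeriod τ b, hp, ?_, ?_, ?_⟩
  · rw [← iterate_eq_pow]
    exact Function.iterate_minimalPeriod
  · intro i hi j hj h
    rw [← iterate_eq_pow, ← iterate_eq_pow] at h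
    exact Function.iterate_injOn_Iio_minimalPeriod hi hj h
  · intro a ha
    obtain ⟨i, rfl⟩ := ha.exists_nat_pow_eq
    refine ⟨i % Function.minimalPeriod τ b, Nat.mod_lt _ hp, ?_⟩
    rw [← iterate_eq_pow, ← iterate_eq_pow, Function.iterate_mod_minimalPeriod_eq]

theorem pow_succ_apply (τ : Perm A) (k : ℕ) (b : A) : (τ ^ (k + 1)) b = τ ((τ ^ k) b) := by
  rw [pow_succ', mul_apply]

theorem sameCycle_pow (τ : Perm A) (k : ℕ) (b : A) : τ.SameCycle b ((τ ^ k) b) :=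
  sameCycle_pow_right.2 (SameCycle.refl _ _)

variable [Finite A] [DecidableEq A] {head : A → V} {c τ : Perm A} {b : A} {l : ℕ}

namespace IsWord

/-- The positions in `(i, j]` close up on themselves: the transposition sends the element at `j` to
position `i + 1`. -/
theorem not_sameCycle_mul_swap (h : IsWord τ b l) {i j k k' : ℕ} (hij : i < j) (hj : j < l)
    (hik : i < k) (hkj : k ≤ j) (hk' : k' < l) (hout : k' ≤ i ∨ j < k') :
    ¬ (τ * swap ((τ ^ i) b) ((τ ^ j) b)).SameCycle ((τ ^ k) b) ((τ ^ k') b) := by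
  intro hs
  have := hs.mem_of_forall_mem (p := fun a => ∃ n, i < n ∧ n ≤ j ∧ (τ ^ n) b = a) ?_
    ⟨k, hik, hkj, rfl⟩
  · obtain ⟨n, h1, h2, h3⟩ := this
    have := h.inj n (by omega) k' hk' h3
    omega
  · rintro _ ⟨n, h1, h2, rfl⟩
    rcases h2.lt_or_eq with h2 | rfl
    · refine ⟨n + 1, by omega, h2, ?_⟩
      rw [mul_apply, swap_apply_of_ne_of_ne, pow_succ_apply]
      · intro he
        have := h.inj _ (by omega) _ (by omega) he
        omega
      · intro he
        have := h.inj _ (by omega) _ (by omega) he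
        omega
    · refine ⟨i + 1, by omega, hij, ?_⟩
      rw [mul_apply, swap_apply_right, pow_succ_apply]

/-- The split has just two parts, and the one containing position `j` stays inside `(i, j]`. -/
theorem sameCycle_mul_swap_of_out (h : IsWord τ b l) {i j k : ℕ} (hij : i < j)
    (hj : j < l) (hk : k < l) (hout : k ≤ i ∨ j < k) :
    (τ * swap ((τ ^ i) b) ((τ ^ j) b)).SameCycle ((τ ^ i) b) ((τ ^ k) b) := by
  have hs : τ.SameCycle ((τ ^ i) b) ((τ ^ j) b) := (sameCycle_pow _ _ _).symm.trans
    (sameCycle_pow _ _ _)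
  have hs' : τ.SameCycle ((τ ^ i) b) ((τ ^ k) b) := (sameCycle_pow _ _ _).symm.trans
    (sameCycle_pow _ _ _)
  rcases hs.mul_swap_left_or_right hs' with h' | h'
  · exact h'
  · exact absurd h' (h.not_sameCycle_mul_swap hij hj hij le_rfl hk hout)

end IsWord

/-- On the word of a cycle, two visits `y < y'` to a vertex that meets another cycle do not
separate two visits to a vertex that meets a third cycle. -/
theorem Minimal.not_linked_word (h : Minimal head c τ) (hw : IsWord τ b l) {x z : A}
    (hx : ¬ τ.SameCycle b x) (hz : ¬ τ.SameCycle b z) (hxz : ¬ τ.SameCycle x z)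
    {y y' p q : ℕ} (hy : y < y') (hy' : y' < l) (hyp : y < p) (hpy : p ≤ y') (hq : q < l)
    (hout : q ≤ y ∨ y' < q) (h1 : head ((τ ^ y) b) = head x) (h2 : head ((τ ^ y') b) = head x)
    (h3 : head ((τ ^ p) b) = head z) (h4 : head ((τ ^ q) b) = head z) : False := by
  refine hw.not_sameCycle_mul_swap hy hy' hyp hpy hq hout ?_
  have s : ∀ i j, τ.SameCycle ((τ ^ i) b) ((τ ^ j) b) := fun i j =>
    (sameCycle_pow _ _ _).symm.trans (sameCycle_pow _ _ _)
  exact h.not_linked (h1.trans h2.symm) h1.symm (s _ _)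
    (fun h' => hx ((sameCycle_pow _ _ _).trans h'.symm)) (s _ _) (s _ _) (h3.trans h4.symm) h3.symm
    (fun h' => hz ((sameCycle_pow _ _ _).trans h')) hxz

/-- Two consecutive moves that make three cycles meet at the vertex visited at `p` and `q`. -/
theorem Minimal.not_linked_twice (h : Minimal head c τ) (hw : IsWord τ b l) {x z : A}
    (hx : ¬ τ.SameCycle b x) (hz : ¬ τ.SameCycle b z) (hxz : ¬ τ.SameCycle x z)
    {y y' a r s p q : ℕ} (hya : y < a) (hay : a < y') (hy' : y' < l)
    (hr : r < y ∨ y' < r) (hs : s < y ∨ y' < s) (hsl : s < l)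
    (hrp : r < p) (hps : p ≤ s) (hp : p < y ∨ y' < p)
    (hql : q < l) (hq : q < y ∨ y' < q) (hout : q ≤ r ∨ s < q)
    (h1 : head ((τ ^ y) b) = head x) (h2 : head ((τ ^ y') b) = head x)
    (h3 : head ((τ ^ a) b) = head ((τ ^ r) b)) (h4 : head ((τ ^ r) b) = head ((τ ^ s) b))
    (h5 : head ((τ ^ p) b) = head z) (h6 : head ((τ ^ q) b) = head z) : False := by
  have hS : ∀ i j, τ.SameCycle ((τ ^ i) b) ((τ ^ j) b) := fun i j =>
    (sameCycle_pow _ _ _).symm.trans (sameCycle_pow _ _ _)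
  have hxi : ∀ i, ¬ τ.SameCycle x ((τ ^ i) b) := fun i h' =>
    hx ((sameCycle_pow _ _ _).trans h'.symm)
  have hyy : y < y' := by omega
  have hne : (τ ^ y) b ≠ (τ ^ y') b := fun he => by
    have := hw.inj _ (by omega) _ hy' he
    omega
  -- This first move separates the visit `a` from all positions outside `[y, y']`, which stay
  -- together.
  obtain ⟨τ', hmin, hm⟩ := h.exists_move (h1.trans h2.symm) h1.symm hne (hS _ _) (hxi _)
  have out : ∀ k < l, (k < y ∨ y' < k) →
      (τ * swap ((τ ^ y) b) ((τ ^ y') b)).SameCycle ((τ ^ y) b) ((τ ^ k) b) := fun k hk hk' =>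
    hw.sameCycle_mul_swap_of_out hyy hy' hk (by omega)
  have same : ∀ i < l, ∀ j < l, (i < y ∨ y' < i) → (j < y ∨ y' < j) →
      τ'.SameCycle ((τ ^ i) b) ((τ ^ j) b) := fun i hi j hj hi' hj' => by
    rw [hm.sameCycle_iff_of_sameCycle (hS _ _) (hS _ _)]
    exact (out i hi hi').symm.trans (out j hj hj')
  have hzτ : ∀ i, ¬ τ'.SameCycle ((τ ^ i) b) z := fun i h' => by
    rw [sameCycle_comm, hm.sameCycle_iff_of_not hxz
      (fun h' => hz ((sameCycle_pow _ _ _).trans h'))] at h'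
    exact hz ((sameCycle_pow _ _ _).trans h'.symm)
  -- The cycle of `a` is now a different cycle at the vertex of `r` and `s`, so splitting at `r` and
  -- `s` must leave `p` and `q` together.
  have key := hmin.not_linked (x := (τ ^ a) b) (y := (τ ^ r) b) (y' := (τ ^ s) b)
    (p := (τ ^ p) b) (q := (τ ^ q) b) (z := z) h4 h3
    (same _ (by omega) _ hsl hr hs)
    (fun h' => by
      rw [hm.sameCycle_iff_of_sameCycle (hS _ _) (hS _ _)] at h'
      exact hw.not_sameCycle_mul_swap hyy hy' hya hay.le (by omega) (by omega) h')
    (same _ (by omega) _ (by omega) hr hp) (same _ (by omega) _ hql hr hq) (h5.trans h6.symm)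
    h5.symm (hzτ _) (hzτ _)
  obtain ⟨y₀, hy₀, rfl⟩ := hm.exists_swap
  -- The positions in `(r, s]`, together with the cycle of `x` if it was spliced in among them, form
  -- a set that is invariant under the moved and then split permutation. It contains `p` but not
  -- `q`.
  obtain ⟨S, hS_def⟩ : ∃ S : A → Prop, ∀ e, S e ↔ ∃ n, r < n ∧ n ≤ s ∧ (τ ^ n) b = e :=
    ⟨_, fun _ => Iff.rfl⟩
  have hSi : ∀ i < l, S ((τ ^ i) b) ↔ r < i ∧ i ≤ s := by
    intro i hi
    rw [hS_def]
    constructor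
    · rintro ⟨n, hn1, hn2, hn3⟩
      have := hw.inj n (by omega) i hi hn3
      omega
    · exact fun h' => ⟨i, h'.1, h'.2, rfl⟩
  have hSx : ∀ e, S e → ¬ τ.SameCycle x e := by
    intro e he
    obtain ⟨n, -, -, rfl⟩ := (hS_def e).1 he
    exact hxi n
  have hne' : ∀ i < l, ∀ j < l, i ≠ j → (τ ^ i) b ≠ (τ ^ j) b := fun i hi j hj hij he =>
    hij (hw.inj i hi j hj he)
  have hnx : ∀ i, (τ ^ i) b ≠ x := fun i he => hxi i (he ▸ SameCycle.refl _ _)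
  have hy₀S : (S y₀ ↔ S ((τ ^ y) b)) ∧ (S y₀ ↔ S ((τ ^ y') b)) := by
    rcases hy₀ with rfl | rfl <;> rw [hSi _ (by omega), hSi _ (by omega)] <;> omega
  have hsucc : S y₀ → S (τ ((τ ^ y) b)) ∧ S (τ ((τ ^ y') b)) := by
    intro h'
    have h1 := (hSi _ (by omega)).1 (hy₀S.1.1 h')
    have h2 := (hSi _ (by omega)).1 (hy₀S.2.1 h')
    exact ⟨(hS_def _).2 ⟨y + 1, by omega, by omega, pow_succ_apply _ _ _⟩,
      (hS_def _).2 ⟨y' + 1, by omega, by omega, pow_succ_apply _ _ _⟩⟩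
  have hinv : ∀ e, (S e ∨ (τ.SameCycle x e ∧ S y₀)) →
      (S ((τ * swap ((τ ^ y) b) ((τ ^ y') b) * swap x y₀ * swap ((τ ^ r) b) ((τ ^ s) b)) e) ∨
      (τ.SameCycle x ((τ * swap ((τ ^ y) b) ((τ ^ y') b) * swap x y₀ *
        swap ((τ ^ r) b) ((τ ^ s) b)) e) ∧ S y₀)) := by
    intro e he
    have hr₀ : (τ ^ r) b ≠ y₀ := by
      rcases hy₀ with rfl | rfl <;> exact hne' _ (by omega) _ (by omega) (by omega)
    by_cases e1 : e = (τ ^ r) b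
    · subst e1
      rcases he with he | he
      · have := (hSi _ (by omega)).1 he
        omega
      · exact absurd he.1 (hxi _)
    by_cases e2 : e = (τ ^ s) b
    · subst e2
      left
      simp only [mul_apply]
      rw [swap_apply_right, swap_apply_of_ne_of_ne (hnx _) hr₀,
        swap_apply_of_ne_of_ne (hne' _ (by omega) _ (by omega) (by omega))
        (hne' _ (by omega) _ (by omega) (by omega))]
      exact (hS_def _).2 ⟨r + 1, by omega, by omega, pow_succ_apply _ _ _⟩
    simp only [mul_apply]
    rw [swap_apply_of_ne_of_ne e1 e2]
    by_cases e3 : e = x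
    · subst e3
      have h₀ : S y₀ := by
        rcases he with he | he
        · exact absurd (SameCycle.refl _ _) (hSx _ he)
        · exact he.2
      left
      rw [swap_apply_left]
      rcases hy₀ with rfl | rfl
      · rw [swap_apply_left]; exact (hsucc h₀).2
      · rw [swap_apply_right]; exact (hsucc h₀).1
    by_cases e4 : e = y₀
    · subst e4
      have h₀ : S e := by
        rcases he with he | he
        · exact he
        · exact he.2
      right
      rw [swap_apply_right, swap_apply_of_ne_of_ne (hnx _).symm (hnx _).symm]
      exact ⟨sameCycle_apply_self _ _, h₀⟩
    rw [swap_apply_of_ne_of_ne e3 e4]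
    by_cases e5 : e = (τ ^ y) b
    · subst e5
      have h₀ : S y₀ := by
        rcases he with he | he
        · exact hy₀S.1.2 he
        · exact he.2
      rw [swap_apply_left]
      exact Or.inl (hsucc h₀).2
    by_cases e6 : e = (τ ^ y') b
    · subst e6
      have h₀ : S y₀ := by
        rcases he with he | he
        · exact hy₀S.2.2 he
        · exact he.2
      rw [swap_apply_right]
      exact Or.inl (hsucc h₀).1
    rw [swap_apply_of_ne_of_ne e5 e6]
    rcases he with he | he
    · obtain ⟨n, hn1, hn2, rfl⟩ := (hS_def e).1 he
      have hns : n ≠ s := fun h' => e2 (by rw [h'])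
      exact Or.inl ((hS_def _).2 ⟨n + 1, by omega, by omega, pow_succ_apply _ _ _⟩)
    · exact Or.inr ⟨sameCycle_apply_right.2 he.1, he.2⟩
  have := key.mem_of_forall_mem (p := fun e => S e ∨ (τ.SameCycle x e ∧ S y₀)) hinv
    (Or.inl ((hS_def _).2 ⟨p, hrp, hps, rfl⟩))
  rcases this with h' | h'
  · have := (hSi _ hql).1 h'
    omega
  · exact hxi _ h'.1

end DirectedRotation

/-! ### Counting vertices in gaps. -/

namespace DirectedRotation

section Counting

variable {V : Type*} [DecidableEq V]

/-- A dense graph on `T` cannot have all its edges explained by gaps of at most two vertices. -/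
theorem false_of_gaps (G : SimpleGraph V) [DecidableRel G.Adj] (T : Finset V)
    (I J : V → Prop) [DecidablePred I] [DecidablePred J] (g g' : V → ℕ) (m : ℕ)
    (hT : 3 * m + 3 ≤ T.card)
    (hdeg : ∀ s ∈ T, (T.filter fun t => ¬ G.Adj s t).card ≤ m + 1)
    (hI : (T.filter fun t => ¬ I t).card ≤ 2) (hJ : (T.filter fun t => ¬ J t).card ≤ 2)
    (hg : ∀ s ∈ T, ∀ t ∈ T, ∀ r ∈ T, I s → I t → I r → g s = g t → g s = g r →
      s = t ∨ s = r ∨ t = r)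
    (hg' : ∀ s ∈ T, ∀ t ∈ T, ∀ r ∈ T, J s → J t → J r → g' s = g' t → g' s = g' r →
      s = t ∨ s = r ∨ t = r)
    (hadj : ∀ s ∈ T, ∀ t ∈ T, I s → J s → G.Adj s t → (I t ∧ g s = g t) ∨ (J t ∧ g' s = g' t))
    (hnadj : ∀ s ∈ T, ∀ t ∈ T, ¬ I s → J s → ¬ J t → I t → ¬ G.Adj s t) : False := by
  -- The bound `m + 1` counts `s` as a non-neighbour of itself, so `T` is a clique when `m = 0`.
  have adj_of_zero : m = 0 → ∀ s ∈ T, ∀ t ∈ T, s ≠ t → G.Adj s t := by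
    rintro rfl s hs t ht hst
    by_contra hn
    exact hst (Finset.card_le_one.1 (hdeg s hs) s (by simp [hs]) t (by simp [ht, hn]))
  by_cases hγ : ∃ t ∈ T, I t ∧ J t
  -- Every member of `T` is a non-neighbour of `t` or shares a gap with it, and each of the two gaps
  -- of `t` has at most one other member. Hence `T.card ≤ m + 3`, which forces `m = 0`.
  · obtain ⟨t, ht, hIt, hJt⟩ := hγ
    have h1 : (T.filter fun s => s ≠ t ∧ I s ∧ g t = g s).card ≤ 1 := by
      rw [Finset.card_le_one]
      intro a ha b hb
      simp only [Finset.mem_filter] at ha hb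
      rcases hg t ht a ha.1 b hb.1 hIt ha.2.2.1 hb.2.2.1 ha.2.2.2 hb.2.2.2 with h | h | h
      · exact absurd h.symm ha.2.1
      · exact absurd h.symm hb.2.1
      · exact h
    have h2 : (T.filter fun s => s ≠ t ∧ J s ∧ g' t = g' s).card ≤ 1 := by
      rw [Finset.card_le_one]
      intro a ha b hb
      simp only [Finset.mem_filter] at ha hb
      rcases hg' t ht a ha.1 b hb.1 hJt ha.2.2.1 hb.2.2.1 ha.2.2.2 hb.2.2.2 with h | h | h
      · exact absurd h.symm ha.2.1
      · exact absurd h.symm hb.2.1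
      · exact h
    have h3 : T ⊆ (T.filter fun s => ¬ G.Adj t s) ∪ ((T.filter fun s => s ≠ t ∧ I s ∧ g t = g s) ∪
        (T.filter fun s => s ≠ t ∧ J s ∧ g' t = g' s)) := by
      intro s hs
      simp only [Finset.mem_union, Finset.mem_filter]
      by_cases h : G.Adj t s
      · rcases hadj t ht s hs hIt hJt h with h' | h'
        · exact Or.inr (Or.inl ⟨hs, h.ne', h'⟩)
        · exact Or.inr (Or.inr ⟨hs, h.ne', h'⟩)
      · exact Or.inl ⟨hs, h⟩
    have h4 := Finset.card_le_card h3
    have h5 := (Finset.card_union_le _ _).trans (add_le_add_right (Finset.card_union_le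
      (T.filter fun s => s ≠ t ∧ I s ∧ g t = g s) (T.filter fun s => s ≠ t ∧ J s ∧ g' t = g' s))
      (T.filter fun s => ¬ G.Adj t s).card)
    have h6 := hdeg t ht
    have hm : m = 0 := by omega
    have hadj' := adj_of_zero hm
    obtain ⟨a, ha, b, hb, hab⟩ := Finset.one_lt_card.1
      (show 1 < (T.erase t).card by rw [Finset.card_erase_of_mem ht]; omega)
    rw [Finset.mem_erase] at ha hb
    -- the argument for one neighbour in a gap of each kind
    have key : ∀ a ∈ T, ∀ b ∈ T, a ≠ t → b ≠ t → a ≠ b → (I a ∧ g t = g a) →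
        (J b ∧ g' t = g' b) → False := by
      intro a ha b hb hat hbt hab hga hgb
      by_cases hJa : J a
      · rcases hadj a ha b hb hga.1 hJa (hadj' a ha b hb hab) with h | h
        · rcases hg t ht a ha b hb hIt hga.1 h.1 hga.2 (hga.2.trans h.2) with h | h | h
          · exact hat h.symm
          · exact hbt h.symm
          · exact hab h
        · rcases hg' t ht a ha b hb hJt hJa hgb.1 (hgb.2.trans h.2.symm) hgb.2 with h | h | h
          · exact hat h.symm
          · exact hbt h.symm
          · exact hab h
      by_cases hIb : I b
      · rcases hadj b hb a ha hIb hgb.1 (hadj' b hb a ha hab.symm) with h | h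
        · rcases hg t ht a ha b hb hIt hga.1 hIb hga.2 (hga.2.trans h.2.symm) with h | h | h
          · exact hat h.symm
          · exact hbt h.symm
          · exact hab h
        · exact hJa h.1
      · exact hnadj b hb a ha hIb hgb.1 hJa hga.1 (hadj' b hb a ha hab.symm)
    rcases hadj t ht a ha.2 hIt hJt (hadj' t ht a ha.2 ha.1.symm) with h | h <;>
    rcases hadj t ht b hb.2 hIt hJt (hadj' t ht b hb.2 hb.1.symm) with h' | h'
    · rcases hg t ht a ha.2 b hb.2 hIt h.1 h'.1 h.2 h'.2 with h | h | h
      · exact ha.1 h.symm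
      · exact hb.1 h.symm
      · exact hab h
    · exact key a ha.2 b hb.2 ha.1 hb.1 hab h h'
    · exact key b hb.2 a ha.2 hb.1 ha.1 hab.symm h' h
    · rcases hg' t ht a ha.2 b hb.2 hJt h.1 h'.1 h.2 h'.2 with h | h | h
      · exact ha.1 h.symm
      · exact hb.1 h.symm
      · exact hab h
  -- Every member of `T` now fails `I` or `J`, so `T.card ≤ 4` and `m = 0`. The clique `T` then
  -- contains an edge forbidden by `hnadj`.
  · push Not at hγ
    have h3 : T ⊆ (T.filter fun t => ¬ I t) ∪ (T.filter fun t => ¬ J t) := by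
      intro s hs
      simp only [Finset.mem_union, Finset.mem_filter]
      by_cases h : I s
      · exact Or.inr ⟨hs, hγ s hs h⟩
      · exact Or.inl ⟨hs, h⟩
    have h4 := (Finset.card_le_card h3).trans (Finset.card_union_le _ _)
    have hm : m = 0 := by omega
    have ex : ∀ (I : V → Prop) [DecidablePred I], (T.filter fun t => ¬ I t).card ≤ 2 →
        ∃ s ∈ T, I s := by
      intro I _ hI
      by_contra hcon
      push Not at hcon
      rw [Finset.filter_true_of_mem hcon] at hI
      omega
    obtain ⟨s, hs, hIs⟩ := ex I hI
    obtain ⟨t, ht, hJt⟩ := ex J hJ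
    have hJs := hγ s hs hIs
    have hIt : ¬ I t := fun h => hγ t ht h hJt
    exact hnadj t ht s hs hIt hJt hJs hIs (adj_of_zero hm t ht s hs (by rintro rfl; exact hIt hIs))

end Counting

section Last

variable (P : ℕ → Prop) [DecidablePred P]

/-- With `P` marking the visits to a vertex, `Nat.findGreatest P` gives the last visit before a
position and thus labels its gap. -/
theorem findGreatest_eq_of_no_between {k k' : ℕ} (hk : ¬ P k) (hk' : ¬ P k')
    (h : ∀ y, k < y → y < k' → ¬ P y) (h' : ∀ y, k' < y → y < k → ¬ P y) :
    Nat.findGreatest P k = Nat.findGreatest P k' := by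
  have key : ∀ k k', k ≤ k' → ¬ P k' → (∀ y, k < y → y < k' → ¬ P y) →
      Nat.findGreatest P k = Nat.findGreatest P k' := by
    intro k k' hle hk' h
    symm
    rw [Nat.findGreatest_eq_iff]
    refine ⟨(Nat.findGreatest_le k).trans hle, fun h0 => Nat.findGreatest_of_ne_zero rfl h0, ?_⟩
    intro y hy hy'
    rcases le_or_gt y k with h1 | h1
    · exact Nat.findGreatest_is_greatest hy h1
    · rcases hy'.lt_or_eq with h2 | rfl
      · exact h y h1 h2
      · exact hk'
  rcases le_total k k' with hle | hle
  · exact key k k' hle hk' h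
  · exact (key k' k hle hk h').symm

/-- A gap has one first and one last position. The conditions `0 < k` and `0 < k'` guard the
truncated subtraction. -/
theorem eq_of_findGreatest_eq {k k' : ℕ} (hk : ¬ P k) (hk' : ¬ P k')
    (he : Nat.findGreatest P k = Nat.findGreatest P k')
    (h : (P (k - 1) ∧ P (k' - 1) ∧ 0 < k ∧ 0 < k') ∨ (P (k + 1) ∧ P (k' + 1))) : k = k' := by
  rcases h with ⟨h1, h2, h3, h4⟩ | ⟨h1, h2⟩
  · have e : ∀ k, 0 < k → ¬ P k → P (k - 1) → Nat.findGreatest P k = k - 1 := by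
      intro k h3 hk h1
      rw [Nat.findGreatest_eq_iff]
      refine ⟨Nat.sub_le _ _, fun _ => h1, fun y hy hy' => ?_⟩
      rwa [show y = k by omega]
    rw [e k h3 hk h1, e k' h4 hk' h2] at he
    omega
  · by_contra hne
    rcases lt_or_gt_of_ne hne with hlt | hlt
    · have := Nat.le_findGreatest (P := P) (m := k + 1) (n := k') hlt h1
      have := Nat.findGreatest_le (P := P) k
      omega
    · have := Nat.le_findGreatest (P := P) (m := k' + 1) (n := k) hlt h2
      have := Nat.findGreatest_le (P := P) k'
      omega

end Last

/-! ### Two vertices where different cycles meet the largest one. -/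

variable {A V : Type*} {head : A → V} {c τ : Perm A} {b : A} {l i₁ j₀ j₁ : ℕ} {xu xw : A}

/-- The largest cycle of an optimal permutation starts at a vertex that another cycle meets at
`xu`; it makes all its visits to this vertex (the last of them at `i₁`) before those to a second
vertex, from `j₀` to `j₁`, that a third cycle meets at `xw`. -/
structure Config [Finite A] (head : A → V) (c τ : Perm A) (b : A) (l i₁ j₀ j₁ : ℕ) (xu xw : A) :
    Prop where
  opt : Optimal head c τ b
  word : IsWord τ b l
  not_u : ¬ τ.SameCycle b xu
  not_w : ¬ τ.SameCycle b xw
  not_uw : ¬ τ.SameCycle xu xw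
  head_zero : head ((τ ^ 0) b) = head xu
  head_i₁ : head ((τ ^ i₁) b) = head xu
  head_j₀ : head ((τ ^ j₀) b) = head xw
  head_j₁ : head ((τ ^ j₁) b) = head xw
  le_i₁ : ∀ k < l, head ((τ ^ k) b) = head xu → k ≤ i₁
  j₀_le : ∀ k < l, head ((τ ^ k) b) = head xw → j₀ ≤ k
  le_j₁ : ∀ k < l, head ((τ ^ k) b) = head xw → k ≤ j₁
  i₁_lt : i₁ < j₀
  j₁_lt : j₁ < l

/-- Visited strictly between `lo` and `hi`, next to a visit to `r`. -/
def Inner (head : A → V) (τ : Perm A) (b : A) (lo hi : ℕ) (r t : V) : Prop :=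
  ∃ k, (lo < k ∧ k < hi ∧ head ((τ ^ k) b) = t) ∧
    (head ((τ ^ (k - 1)) b) = r ∨ head ((τ ^ (k + 1)) b) = r)

/-- Visited next to `x` by the cycle of `x`. -/
def Near (head : A → V) (τ : Perm A) (x : A) (t : V) : Prop :=
  t = head (τ x) ∨ t = head (τ.symm x)

theorem Near.exists_sameCycle {x : A} {t : V} (h : Near head τ x t) :
    ∃ e, head e = t ∧ τ.SameCycle x e := by
  rcases h with rfl | rfl
  · exact ⟨_, rfl, sameCycle_apply_self _ _⟩
  · exact ⟨_, rfl, sameCycle_symm_apply_right.2 (SameCycle.refl _ _)⟩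

/-- Adjacent vertices are consecutive on the word or on another cycle. -/
theorem IsWord.adj_cases (hw : IsWord τ b l) {G : SimpleGraph V}
    (hG : ∀ u v, G.Adj u v →
      ∃ e, (head e = u ∧ head (τ e) = v) ∨ (head e = v ∧ head (τ e) = u))
    {s t : V} (h : G.Adj s t) :
    (∃ k < l, (head ((τ ^ k) b) = s ∧ head ((τ ^ (k + 1)) b) = t) ∨
      (head ((τ ^ k) b) = t ∧ head ((τ ^ (k + 1)) b) = s)) ∨
    ∃ e, ¬ τ.SameCycle b e ∧
      ((head e = s ∧ head (τ e) = t) ∨ (head e = t ∧ head (τ e) = s)) := by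
  obtain ⟨e, he⟩ := hG s t h
  by_cases hs : τ.SameCycle b e
  · obtain ⟨k, hk, rfl⟩ := hw.surj e hs
    exact Or.inl ⟨k, hk, by simpa only [pow_succ_apply] using he⟩
  · exact Or.inr ⟨e, hs, he⟩

theorem not_sameCycle_of_sameCycle {x e : A} (h : ¬ τ.SameCycle b x) (he : τ.SameCycle x e) :
    ¬ τ.SameCycle b e :=
  fun h' => h (h'.trans he.symm)

variable [Finite A]

namespace Config

variable (hc : Config head c τ b l i₁ j₀ j₁ xu xw)
include hc

theorem j₀_le_j₁ : j₀ ≤ j₁ := hc.j₀_le _ hc.j₁_lt hc.head_j₁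

theorem head_l : head ((τ ^ l) b) = head xu := by
  rw [hc.word.period]
  exact hc.head_zero

variable [DecidableEq A]

theorem eq_of_word {e e' : A} {k : ℕ} (he : ¬ τ.SameCycle b e) (he' : ¬ τ.SameCycle b e')
    (h : head ((τ ^ k) b) = head e) (h' : head e = head e') : e = e' :=
  hc.opt.eq_of_head_eq (sameCycle_pow _ _ _) he he' h' h

theorem ne : head xu ≠ head xw := fun h =>
  hc.not_uw (by rw [hc.eq_of_word hc.not_u hc.not_w hc.head_zero h])

/-- A vertex near both `xu` and `xw` is not on the word. -/
theorem not_near_near {t : V} {k : ℕ} (hk : head ((τ ^ k) b) = t) (hu : Near head τ xu t)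
    (hw : Near head τ xw t) : False := by
  obtain ⟨e, rfl, he⟩ := hu.exists_sameCycle
  obtain ⟨e', he'', he'⟩ := hw.exists_sameCycle
  have := hc.eq_of_word (not_sameCycle_of_sameCycle hc.not_u he) (not_sameCycle_of_sameCycle hc.not_w he') hk he''.symm
  subst this
  exact hc.not_uw (he.trans he'.symm)

/-- An edge at `head xu` is a step of the word or of another cycle; in the latter case the step uses
`xu`, the only visit there from outside the word. The two excluded vertices follow the last visit
and precede the first one cyclically, hence may lie outside the range. -/
theorem near_or_inner_u {G : SimpleGraph V}
    (hG : ∀ u v, G.Adj u v →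
      ∃ e, (head e = u ∧ head (τ e) = v) ∨ (head e = v ∧ head (τ e) = u))
    {t : V} (h : G.Adj (head xu) t) (h1 : t ≠ head ((τ ^ (l - 1)) b))
    (h2 : t ≠ head ((τ ^ (i₁ + 1)) b)) :
    Inner head τ b 0 i₁ (head xu) t ∨ Near head τ xu t := by
  have hne := h.ne
  have := hc.i₁_lt; have := hc.j₁_lt; have := hc.j₀_le_j₁
  rcases hc.word.adj_cases hG h with ⟨k, hk, ⟨h3, h4⟩ | ⟨h3, h4⟩⟩ | ⟨e, he, ⟨h3, h4⟩ | ⟨h3, h4⟩⟩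
  · left
    have hk1 := hc.le_i₁ k hk h3
    have hk2 : k ≠ i₁ := by rintro rfl; exact h2 h4.symm
    have hk3 : k + 1 ≠ i₁ := by rintro rfl; exact hne (hc.head_i₁.symm.trans h4)
    exact ⟨k + 1, ⟨by omega, by omega, h4⟩, Or.inl h3⟩
  · left
    have hk1 : k + 1 ≠ l := by rintro rfl; exact h1 h3.symm
    have hk2 := hc.le_i₁ (k + 1) (by omega) h4
    have hk3 : k ≠ 0 := by rintro rfl; exact hne (hc.head_zero.symm.trans h3)
    exact ⟨k, ⟨by omega, by omega, h3⟩, Or.inr h4⟩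
  · right
    have := hc.eq_of_word hc.not_u he hc.head_zero h3.symm
    subst this
    exact Or.inl h4.symm
  · right
    have := hc.eq_of_word hc.not_u (fun h' => he (sameCycle_apply_right.1 h')) hc.head_zero h4.symm
    subst this
    exact Or.inr (by rw [symm_apply_apply]; exact h3.symm)

theorem near_or_inner_w {G : SimpleGraph V}
    (hG : ∀ u v, G.Adj u v →
      ∃ e, (head e = u ∧ head (τ e) = v) ∨ (head e = v ∧ head (τ e) = u))
    {t : V} (h : G.Adj (head xw) t) (h1 : t ≠ head ((τ ^ (j₀ - 1)) b))
    (h2 : t ≠ head ((τ ^ (j₁ + 1)) b)) :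
    Inner head τ b j₀ j₁ (head xw) t ∨ Near head τ xw t := by
  have hne := h.ne
  have := hc.i₁_lt; have := hc.j₁_lt; have := hc.j₀_le_j₁
  rcases hc.word.adj_cases hG h with ⟨k, hk, ⟨h3, h4⟩ | ⟨h3, h4⟩⟩ | ⟨e, he, ⟨h3, h4⟩ | ⟨h3, h4⟩⟩
  · left
    have hk1 := hc.le_j₁ k hk h3
    have hk0 := hc.j₀_le k hk h3
    have hk2 : k ≠ j₁ := by rintro rfl; exact h2 h4.symm
    have hk3 : k + 1 ≠ j₁ := by rintro rfl; exact hne (hc.head_j₁.symm.trans h4)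
    exact ⟨k + 1, ⟨by omega, by omega, h4⟩, Or.inl h3⟩
  · left
    have hk1 : k + 1 ≠ l := by rintro rfl; exact hc.ne (hc.head_l.symm.trans h4)
    have hk2 := hc.le_j₁ (k + 1) (by omega) h4
    have hk0 := hc.j₀_le (k + 1) (by omega) h4
    have hk3 : k ≠ j₀ := by rintro rfl; exact hne (hc.head_j₀.symm.trans h3)
    have hk4 : j₀ ≠ k + 1 := by
      intro hk4
      apply h1
      rw [← h3, hk4, Nat.add_sub_cancel]
    exact ⟨k, ⟨by omega, by omega, h3⟩, Or.inr h4⟩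
  · right
    have := hc.eq_of_word hc.not_w he hc.head_j₀ h3.symm
    subst this
    exact Or.inl h4.symm
  · right
    have := hc.eq_of_word hc.not_w (fun h' => he (sameCycle_apply_right.1 h')) hc.head_j₀ h4.symm
    subst this
    exact Or.inr (by rw [symm_apply_apply]; exact h3.symm)

/-- Visits to a vertex between visits to the first vertex lie in one gap. -/
theorem gap_u {t : V} (ht : Inner head τ b j₀ j₁ (head xw) t ∨ Near head τ xw t) {k k' y : ℕ}
    (h1 : 0 < k) (h2 : k < y) (h3 : y < k') (h4 : k' < i₁) (hk : head ((τ ^ k) b) = t)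
    (hk' : head ((τ ^ k') b) = t) : head ((τ ^ y) b) ≠ head xu := by
  intro hy
  have := hc.i₁_lt; have := hc.j₁_lt; have := hc.j₀_le_j₁
  rcases ht with ⟨n, ⟨hn1, hn2, hn⟩, -⟩ | ht
  -- The move at `0` and `y` cuts off the visit `k` to `t`; the visits `k'` and `n` to `t` then
  -- separate `j₀` from `j₁`.
  · exact hc.opt.1.not_linked_twice hc.word hc.not_u hc.not_w hc.not_uw (y := 0) (y' := y) (a := k)
      (r := k') (s := n) (p := j₀) (q := j₁) (by omega) (by omega) (by omega) (by omega) (by omega)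
      (by omega) (by omega) (by omega) (by omega) (by omega) (by omega) (by omega) hc.head_zero hy
      (hk.trans hk'.symm) (hk'.trans hn.symm) hc.head_j₀ hc.head_j₁
  · obtain ⟨e, he, hs⟩ := ht.exists_sameCycle
    exact hc.opt.1.not_linked_word hc.word hc.not_u (not_sameCycle_of_sameCycle hc.not_w hs)
      (fun h' => hc.not_uw (h'.trans hs.symm)) (y := 0) (y' := y) (p := k) (q := k') (by omega)
      (by omega) (by omega) (by omega) (by omega) (by omega) hc.head_zero hy (hk.trans he.symm)
      (hk'.trans he.symm)

/-- Visits to a vertex between visits to the second vertex lie in one gap. -/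
theorem gap_w {t : V} (ht : Inner head τ b 0 i₁ (head xu) t ∨ Near head τ xu t) {k k' y : ℕ}
    (h1 : j₀ < k) (h2 : k < y) (h3 : y < k') (h4 : k' < j₁) (hk : head ((τ ^ k) b) = t)
    (hk' : head ((τ ^ k') b) = t) : head ((τ ^ y) b) ≠ head xw := by
  intro hy
  have := hc.i₁_lt; have := hc.j₁_lt; have := hc.j₀_le_j₁
  rcases ht with ⟨n, ⟨hn1, hn2, hn⟩, -⟩ | ht
  -- Here the move at `0` and `i₁` cuts off the visit `n`, and the visits `k` and `k'` separate `y`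
  -- from `j₀`.
  · exact hc.opt.1.not_linked_twice hc.word hc.not_u hc.not_w hc.not_uw (y := 0) (y' := i₁) (a := n)
      (r := k) (s := k') (p := y) (q := j₀) (by omega) (by omega) (by omega) (by omega) (by omega)
      (by omega) (by omega) (by omega) (by omega) (by omega) (by omega) (by omega) hc.head_zero
      hc.head_i₁ (hn.trans hk.symm) (hk.trans hk'.symm) hy hc.head_j₀
  · obtain ⟨e, he, hs⟩ := ht.exists_sameCycle
    exact hc.opt.1.not_linked_word hc.word hc.not_w (not_sameCycle_of_sameCycle hc.not_u hs)
      (fun h' => hc.not_uw (hs.trans h'.symm)) (y := j₀) (y' := y) (p := k) (q := k') (by omega)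
      (by omega) (by omega) (by omega) (by omega) (by omega) hc.head_j₀ hy (hk.trans he.symm)
      (hk'.trans he.symm)

/-- The cycle of `xw` passes through `t`, so the visits `0` and `i₁` to the first vertex may not
separate two visits to `t`. -/
theorem only_u {t : V} (hi : Inner head τ b 0 i₁ (head xu) t) (ht : Near head τ xw t) {k : ℕ}
    (hk : k < l) (hkt : head ((τ ^ k) b) = t) : k ≤ i₁ := by
  by_contra hlt
  have := hc.i₁_lt; have := hc.j₁_lt; have := hc.j₀_le_j₁
  obtain ⟨n, ⟨hn1, hn2, hn⟩, -⟩ := hi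
  obtain ⟨e, he, hs⟩ := ht.exists_sameCycle
  exact hc.opt.1.not_linked_word hc.word hc.not_u (not_sameCycle_of_sameCycle hc.not_w hs)
    (fun h' => hc.not_uw (h'.trans hs.symm)) (y := 0) (y' := i₁) (p := n) (q := k) (by omega)
    (by omega) (by omega) (by omega) (by omega) (by omega) hc.head_zero hc.head_i₁ (hn.trans he.symm)
    (hkt.trans he.symm)

theorem only_w {t : V} (hi : Inner head τ b j₀ j₁ (head xw) t) (ht : Near head τ xu t) {k : ℕ}
    (hk : k < l) (hkt : head ((τ ^ k) b) = t) : j₀ ≤ k := by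
  by_contra hlt
  have := hc.i₁_lt; have := hc.j₁_lt; have := hc.j₀_le_j₁
  obtain ⟨n, ⟨hn1, hn2, hn⟩, -⟩ := hi
  obtain ⟨e, he, hs⟩ := ht.exists_sameCycle
  exact hc.opt.1.not_linked_word hc.word hc.not_w (not_sameCycle_of_sameCycle hc.not_u hs)
    (fun h' => hc.not_uw (hs.trans h'.symm)) (y := j₀) (y' := j₁) (p := n) (q := k) (by omega)
    (by omega) (by omega) (by omega) (by omega) (by omega) hc.head_j₀ hc.head_j₁ (hn.trans he.symm)
    (hkt.trans he.symm)

/-- A vertex inside both ranges is met by the largest cycle only. -/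
theorem sameCycle_of_inner_inner {t : V} (hi : Inner head τ b 0 i₁ (head xu) t)
    (hj : Inner head τ b j₀ j₁ (head xw) t) {e : A} (he : head e = t) : τ.SameCycle b e := by
  by_contra hs
  have := hc.i₁_lt; have := hc.j₁_lt; have := hc.j₀_le_j₁
  obtain ⟨n, ⟨hn1, hn2, hn⟩, -⟩ := hi
  obtain ⟨n', ⟨hn1', hn2', hn'⟩, -⟩ := hj
  by_cases hu : τ.SameCycle xu e
  · exact hc.opt.1.not_linked_word hc.word hc.not_w hs (fun h' => hc.not_uw (hu.trans h'.symm))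
      (y := j₀) (y' := j₁) (p := n') (q := n) (by omega) (by omega) (by omega) (by omega) (by omega)
      (by omega) hc.head_j₀ hc.head_j₁ (hn'.trans he.symm) (hn.trans he.symm)
  · exact hc.opt.1.not_linked_word hc.word hc.not_u hs hu
      (y := 0) (y' := i₁) (p := n) (q := n') (by omega) (by omega) (by omega) (by omega) (by omega)
      (by omega) hc.head_zero hc.head_i₁ (hn.trans he.symm) (hn'.trans he.symm)

/-- The move at `0` and `i₁` cuts off the visit `n`; a visit outside both ranges, paired with `n'`,
would then separate `j₀` from `j₁`. -/
theorem lt_or_lt_of_inner_inner {t : V} (hi : Inner head τ b 0 i₁ (head xu) t)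
    (hj : Inner head τ b j₀ j₁ (head xw) t) {k : ℕ} (hk : k < l) (hkt : head ((τ ^ k) b) = t) :
    k ≤ i₁ ∨ (j₀ ≤ k ∧ k ≤ j₁) := by
  by_contra hcon
  have := hc.i₁_lt; have := hc.j₁_lt; have := hc.j₀_le_j₁
  obtain ⟨n, ⟨hn1, hn2, hn⟩, -⟩ := hi
  obtain ⟨n', ⟨hn1', hn2', hn'⟩, -⟩ := hj
  rcases lt_or_ge k j₀ with h | h
  · exact hc.opt.1.not_linked_twice hc.word hc.not_u hc.not_w hc.not_uw (y := 0) (y' := i₁) (a := n)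
      (r := k) (s := n') (p := j₀) (q := j₁) (by omega) (by omega) (by omega) (by omega) (by omega)
      (by omega) (by omega) (by omega) (by omega) (by omega) (by omega) (by omega) hc.head_zero
      hc.head_i₁ (hn.trans hkt.symm) (hkt.trans hn'.symm) hc.head_j₀ hc.head_j₁
  · exact hc.opt.1.not_linked_twice hc.word hc.not_u hc.not_w hc.not_uw (y := 0) (y' := i₁) (a := n)
      (r := n') (s := k) (p := j₁) (q := j₀) (by omega) (by omega) (by omega) (by omega) (by omega)
      (by omega) (by omega) (by omega) (by omega) (by omega) (by omega) (by omega) hc.head_zero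
      hc.head_i₁ (hn.trans hn'.symm) (hn'.trans hkt.symm) hc.head_j₁ hc.head_j₀

end Config

end DirectedRotation

/-! ### Excluding such a configuration in a dense graph. -/

namespace DirectedRotation

variable {A V : Type*} {head : A → V} {c τ : Perm A} {b : A} {l i₁ j₀ j₁ : ℕ} {xu xw : A}

/-- Of three vertices in one gap, two are at the same end. -/
theorem eq_or_eq_of_same_gap [DecidableEq V] {f : ℕ → V} {r : V} {p : V → ℕ} {s t q : V}
    (hs : s ≠ r ∧ 0 < p s ∧ f (p s) = s ∧ (f (p s - 1) = r ∨ f (p s + 1) = r))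
    (ht : t ≠ r ∧ 0 < p t ∧ f (p t) = t ∧ (f (p t - 1) = r ∨ f (p t + 1) = r))
    (hq : q ≠ r ∧ 0 < p q ∧ f (p q) = q ∧ (f (p q - 1) = r ∨ f (p q + 1) = r))
    (h : Nat.findGreatest (fun y => f y = r) (p s) = Nat.findGreatest (fun y => f y = r) (p t))
    (h' : Nat.findGreatest (fun y => f y = r) (p s) = Nat.findGreatest (fun y => f y = r) (p q)) :
    s = t ∨ s = q ∨ t = q := by
  have key : ∀ s t : V, (s ≠ r ∧ 0 < p s ∧ f (p s) = s) → (t ≠ r ∧ 0 < p t ∧ f (p t) = t) →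
      Nat.findGreatest (fun y => f y = r) (p s) = Nat.findGreatest (fun y => f y = r) (p t) →
      ((f (p s - 1) = r ∧ f (p t - 1) = r) ∨ (f (p s + 1) = r ∧ f (p t + 1) = r)) → s = t := by
    rintro s t ⟨s1, s2, s3⟩ ⟨t1, t2, t3⟩ h h2
    have := eq_of_findGreatest_eq (fun y => f y = r) (by rwa [s3]) (by rwa [t3]) h
      (h2.imp (fun h => ⟨h.1, h.2, s2, t2⟩) id)
    exact s3.symm.trans ((congrArg f this).trans t3)
  have a := key s t ⟨hs.1, hs.2.1, hs.2.2.1⟩ ⟨ht.1, ht.2.1, ht.2.2.1⟩ h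
  have b := key s q ⟨hs.1, hs.2.1, hs.2.2.1⟩ ⟨hq.1, hq.2.1, hq.2.2.1⟩ h'
  have d := key t q ⟨ht.1, ht.2.1, ht.2.2.1⟩ ⟨hq.1, hq.2.1, hq.2.2.1⟩ (h.symm.trans h')
  rcases hs.2.2.2 with h1 | h1 <;> rcases ht.2.2.2 with h2 | h2 <;>
    rcases hq.2.2.2 with h3 | h3
  · exact Or.inl (a (Or.inl ⟨h1, h2⟩))
  · exact Or.inl (a (Or.inl ⟨h1, h2⟩))
  · exact Or.inr (Or.inl (b (Or.inl ⟨h1, h3⟩)))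
  · exact Or.inr (Or.inr (d (Or.inr ⟨h2, h3⟩)))
  · exact Or.inr (Or.inr (d (Or.inl ⟨h2, h3⟩)))
  · exact Or.inr (Or.inl (b (Or.inr ⟨h1, h3⟩)))
  · exact Or.inl (a (Or.inr ⟨h1, h2⟩))
  · exact Or.inl (a (Or.inr ⟨h1, h2⟩))

variable [Finite A] [DecidableEq A]

namespace Config

variable (hc : Config head c τ b l i₁ j₀ j₁ xu xw)
include hc

/-- If the two vertices are adjacent then they are next to each other on the largest cycle. -/
theorem adj_imp {G : SimpleGraph V}
    (hG : ∀ u v, G.Adj u v →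
      ∃ e, (head e = u ∧ head (τ e) = v) ∨ (head e = v ∧ head (τ e) = u))
    (h : G.Adj (head xu) (head xw)) : i₁ + 1 = j₀ ∨ j₁ + 1 = l := by
  have := hc.i₁_lt; have := hc.j₁_lt; have := hc.j₀_le_j₁
  rcases hc.word.adj_cases hG h with ⟨k, hk, ⟨h3, h4⟩ | ⟨h3, h4⟩⟩ | ⟨e, he, ⟨h3, h4⟩ | ⟨h3, h4⟩⟩
  · have h1 := hc.le_i₁ k hk h3
    have h2 := hc.j₀_le (k + 1) (by omega) h4
    omega
  · have h1 := hc.j₀_le k hk h3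
    have h1' := hc.le_j₁ k hk h3
    rcases Nat.lt_or_ge (k + 1) l with h5 | h5
    · have h2 := hc.le_i₁ (k + 1) h5 h4
      omega
    · omega
  · have e1 := hc.eq_of_word hc.not_u he hc.head_zero h3.symm
    have he' : ¬ τ.SameCycle b (τ e) := fun h' => he (sameCycle_apply_right.1 h')
    have e2 := hc.eq_of_word hc.not_w he' hc.head_j₀ h4.symm
    exact absurd (by rw [e1, e2]; exact sameCycle_apply_self _ _) hc.not_uw
  · have e1 := hc.eq_of_word hc.not_w he hc.head_j₀ h3.symm
    have he' : ¬ τ.SameCycle b (τ e) := fun h' => he (sameCycle_apply_right.1 h')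
    have e2 := hc.eq_of_word hc.not_u he' hc.head_zero h4.symm
    exact absurd (by rw [e1, e2]; exact (sameCycle_apply_self _ _).symm) hc.not_uw

/-- The count is n - 2m - 4 in both cases. Non-adjacent vertices both lie outside the union of their
neighbourhoods, which gains two and pays for four deletions. For adjacent vertices `adj_imp` shows
that two of the deleted vertices are the given ones themselves, which are not common neighbours. -/
theorem le_card_common [Fintype V] [DecidableEq V] {G : SimpleGraph V} [DecidableRel G.Adj]
    (hG : ∀ u v, G.Adj u v →
      ∃ e, (head e = u ∧ head (τ e) = v) ∨ (head e = v ∧ head (τ e) = u))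
    {m : ℕ} (hn : 5 * m + 7 ≤ Fintype.card V) (hdeg : ∀ v, Fintype.card V ≤ G.degree v + m + 1) :
    3 * m + 3 ≤ ((G.neighborFinset (head xu) ∩ G.neighborFinset (head xw)) \
      {head ((τ ^ (l - 1)) b), head ((τ ^ (i₁ + 1)) b), head ((τ ^ (j₀ - 1)) b),
        head ((τ ^ (j₁ + 1)) b)}).card := by
  set u := head xu with hu
  set w := head xw with hw
  set f : ℕ → V := fun k => head ((τ ^ k) b) with hf
  set N := G.neighborFinset u ∩ G.neighborFinset w with hN
  set B : Finset V := {f (l - 1), f (i₁ + 1), f (j₀ - 1), f (j₁ + 1)} with hB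
  set T := N \ B with hT
  have huw : u ≠ w := hc.ne
  change 3 * m + 3 ≤ T.card
  have h1 := Finset.card_union_add_card_inter (G.neighborFinset u) (G.neighborFinset w)
  rw [G.card_neighborFinset_eq_degree, G.card_neighborFinset_eq_degree, ← hN] at h1
  have hu' := hdeg u
  have hw' := hdeg w
  by_cases hadj : G.Adj u w
  · have h2 : (G.neighborFinset u ∪ G.neighborFinset w).card ≤ Fintype.card V :=
      Finset.card_le_univ _
    obtain ⟨p, q, hpq⟩ : ∃ p q : V, T = N \ {p, q} := by
      rcases hc.adj_imp hG hadj with h | h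
      · refine ⟨f (l - 1), f (j₁ + 1), ?_⟩
        have e1 : f (i₁ + 1) = w := by rw [h]; exact hc.head_j₀
        have e2 : f (j₀ - 1) = u := by rw [← h]; exact hc.head_i₁
        ext t
        simp only [hT, hB, hN, Finset.mem_sdiff, Finset.mem_inter, SimpleGraph.mem_neighborFinset,
          Finset.mem_insert, Finset.mem_singleton, e1, e2]
        constructor
        · tauto
        · rintro ⟨⟨h1, h2⟩, h3⟩
          have := h1.ne'
          have := h2.ne'
          tauto
      · refine ⟨f (i₁ + 1), f (j₀ - 1), ?_⟩
        have e1 : f (l - 1) = w := by rw [← h]; exact hc.head_j₁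
        have e2 : f (j₁ + 1) = u := by rw [h]; exact hc.head_l
        ext t
        simp only [hT, hB, hN, Finset.mem_sdiff, Finset.mem_inter, SimpleGraph.mem_neighborFinset,
          Finset.mem_insert, Finset.mem_singleton, e1, e2]
        constructor
        · tauto
        · rintro ⟨⟨h1, h2⟩, h3⟩
          have := h1.ne'
          have := h2.ne'
          tauto
    have h3 := Finset.le_card_sdiff {p, q} N
    have h4 := Finset.card_le_two (a := p) (b := q)
    rw [hpq]
    omega
  · have h2 : G.neighborFinset u ∪ G.neighborFinset w ⊆ ({u, w} : Finset V)ᶜ := by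
      intro t
      simp only [Finset.mem_union, SimpleGraph.mem_neighborFinset, Finset.mem_compl,
        Finset.mem_insert, Finset.mem_singleton]
      rintro (h | h) (rfl | rfl)
      · exact h.ne rfl
      · exact hadj h
      · exact hadj h.symm
      · exact h.ne rfl
    have h2' := Finset.card_le_card h2
    rw [Finset.card_compl, Finset.card_pair huw] at h2'
    have h3 := Finset.le_card_sdiff B N
    have h4 : B.card ≤ 4 := Finset.card_le_four
    have h5 : T.card = (N \ B).card := rfl
    have h6 : 2 ≤ Fintype.card V := by omega
    omega

set_option maxHeartbeats 800000 in
/-- There are no two vertices as in `Config` in a dense graph. -/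
theorem false_of_dense [Fintype V] {G : SimpleGraph V} [DecidableRel G.Adj]
    (hG : ∀ u v, G.Adj u v →
      ∃ e, (head e = u ∧ head (τ e) = v) ∨ (head e = v ∧ head (τ e) = u))
    {m : ℕ} (hn : 5 * m + 7 ≤ Fintype.card V) (hdeg : ∀ v, Fintype.card V ≤ G.degree v + m + 1) :
    False := by
  classical
  have hi₁ := hc.i₁_lt; have hj₁ := hc.j₁_lt; have hj := hc.j₀_le_j₁
  set u := head xu with hu
  set w := head xw with hw
  set f : ℕ → V := fun k => head ((τ ^ k) b) with hf
  set N := G.neighborFinset u ∩ G.neighborFinset w with hN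
  set B : Finset V := {f (l - 1), f (i₁ + 1), f (j₀ - 1), f (j₁ + 1)} with hB
  set T := N \ B with hT
  have huw : u ≠ w := hc.ne
  have cardT : 3 * m + 3 ≤ T.card := hc.le_card_common hG hn hdeg
  have memT : ∀ t ∈ T, t ≠ u ∧ t ≠ w ∧
      (Inner head τ b 0 i₁ u t ∨ Near head τ xu t) ∧
      (Inner head τ b j₀ j₁ w t ∨ Near head τ xw t) := by
    intro t ht
    simp only [hT, hN, hB, Finset.mem_sdiff, Finset.mem_inter, SimpleGraph.mem_neighborFinset,
      Finset.mem_insert, Finset.mem_singleton, not_or] at ht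
    obtain ⟨⟨h1, h2⟩, h3, h4, h5, h6⟩ := ht
    exact ⟨h1.ne', h2.ne', hc.near_or_inner_u hG h1 h3 h4, hc.near_or_inner_w hG h2 h5 h6⟩
  have nearCard : ∀ x, ∀ I : V → Prop, (∀ t ∈ T, ¬ I t → Near head τ x t) →
      (T.filter fun t => ¬ I t).card ≤ 2 := by
    intro x I h
    refine (Finset.card_le_card (t := {head (τ x), head (τ.symm x)}) ?_).trans Finset.card_le_two
    intro t ht
    rw [Finset.mem_filter] at ht
    rw [Finset.mem_insert, Finset.mem_singleton]
    exact h t ht.1 ht.2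
  have hpu : ∀ t, ∃ k, Inner head τ b 0 i₁ u t → (0 < k ∧ k < i₁ ∧ f k = t) ∧
      (f (k - 1) = u ∨ f (k + 1) = u) := by
    intro t
    by_cases h : Inner head τ b 0 i₁ u t
    · obtain ⟨k, hk⟩ := h
      exact ⟨k, fun _ => hk⟩
    · exact ⟨0, fun h' => absurd h' h⟩
  have hpw : ∀ t, ∃ k, Inner head τ b j₀ j₁ w t → (j₀ < k ∧ k < j₁ ∧ f k = t) ∧
      (f (k - 1) = w ∨ f (k + 1) = w) := by
    intro t
    by_cases h : Inner head τ b j₀ j₁ w t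
    · obtain ⟨k, hk⟩ := h
      exact ⟨k, fun _ => hk⟩
    · exact ⟨0, fun h' => absurd h' h⟩
  choose pu hpu using hpu
  choose pw hpw using hpw
  -- A vertex of `T` that is merely near `xu` is not visited in the first range, by `only_w` or
  -- `not_near_near`.
  have innerU : ∀ s ∈ T, ∀ k < l, f k = s → k ≤ i₁ → Inner head τ b 0 i₁ u s := by
    intro s hs k hk hks hki
    obtain ⟨-, -, h1, h2⟩ := memT s hs
    rcases h1 with h1 | h1
    · exact h1
    rcases h2 with h2 | h2
    · have := hc.only_w h2 h1 hk hks
      omega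
    · exact (hc.not_near_near hks h1 h2).elim
  have innerW : ∀ s ∈ T, ∀ k < l, f k = s → j₀ ≤ k → Inner head τ b j₀ j₁ w s := by
    intro s hs k hk hks hki
    obtain ⟨-, -, h1, h2⟩ := memT s hs
    rcases h2 with h2 | h2
    · exact h2
    rcases h1 with h1 | h1
    · have := hc.only_u h1 h2 hk hks
      omega
    · exact (hc.not_near_near hks h1 h2).elim
  -- By `gap_u` all visits to `s` inside the range lie in one gap, so the label does not depend on
  -- the chosen visit `pu s`.
  have lastU : ∀ s ∈ T, ∀ k, 0 < k → k < i₁ → f k = s → Inner head τ b 0 i₁ u s →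
      Nat.findGreatest (fun y => f y = u) k = Nat.findGreatest (fun y => f y = u) (pu s) := by
    intro s hs k h1 h2 h3 h4
    obtain ⟨h0, -, -, h5⟩ := memT s hs
    obtain ⟨⟨p1, p2, p3⟩, -⟩ := hpu s h4
    refine findGreatest_eq_of_no_between _ (by rwa [h3]) (by rwa [p3]) ?_ ?_
    · intro y hy hy'
      exact hc.gap_u h5 h1 hy hy' p2 h3 p3
    · intro y hy hy'
      exact hc.gap_u h5 p1 hy hy' h2 p3 h3
  have lastW : ∀ s ∈ T, ∀ k, j₀ < k → k < j₁ → f k = s → Inner head τ b j₀ j₁ w s →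
      Nat.findGreatest (fun y => f y = w) k = Nat.findGreatest (fun y => f y = w) (pw s) := by
    intro s hs k h1 h2 h3 h4
    obtain ⟨-, h0, h5, -⟩ := memT s hs
    obtain ⟨⟨p1, p2, p3⟩, -⟩ := hpw s h4
    refine findGreatest_eq_of_no_between _ (by rwa [h3]) (by rwa [p3]) ?_ ?_
    · intro y hy hy'
      exact hc.gap_w h5 h1 hy hy' p2 h3 p3
    · intro y hy hy'
      exact hc.gap_w h5 p1 hy hy' h2 p3 h3
  have consecutive : ∀ s ∈ T, ∀ t ∈ T, (∃ k < l, (f k = s ∧ f (k + 1) = t) ∨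
      (f k = t ∧ f (k + 1) = s)) → ∃ i < l, ∃ j < l, f i = s ∧ f j = t ∧
        (j = i + 1 ∨ i = j + 1) := by
    rintro s hs t ht ⟨k, hk, ⟨h1, h2⟩ | ⟨h1, h2⟩⟩
    · have : k + 1 ≠ l := by
        rintro rfl
        exact (memT t ht).1 (h2.symm.trans hc.head_l)
      exact ⟨k, hk, k + 1, by omega, h1, h2, Or.inl rfl⟩
    · have : k + 1 ≠ l := by
        rintro rfl
        exact (memT s hs).1 (h2.symm.trans hc.head_l)
      exact ⟨k + 1, by omega, k, hk, h2, h1, Or.inr rfl⟩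
  refine false_of_gaps G T (Inner head τ b 0 i₁ u) (Inner head τ b j₀ j₁ w)
    (fun t => Nat.findGreatest (fun y => f y = u) (pu t))
    (fun t => Nat.findGreatest (fun y => f y = w) (pw t)) m cardT ?_ ?_ ?_ ?_ ?_ ?_ ?_
  · intro s _
    have h1 : (T.filter fun t => ¬ G.Adj s t) ⊆ (G.neighborFinset s)ᶜ := by
      intro t ht
      rw [Finset.mem_filter] at ht
      rw [Finset.mem_compl, SimpleGraph.mem_neighborFinset]
      exact ht.2
    have h2 := Finset.card_le_card h1
    rw [Finset.card_compl, G.card_neighborFinset_eq_degree] at h2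
    have := hdeg s
    omega
  · exact nearCard xu _ fun t ht h => (memT t ht).2.2.1.resolve_left h
  · exact nearCard xw _ fun t ht h => (memT t ht).2.2.2.resolve_left h
  · intro s hs t ht r hr is it ir h h'
    have e : ∀ s ∈ T, Inner head τ b 0 i₁ u s → (s ≠ u ∧ 0 < pu s ∧ f (pu s) = s ∧
        (f (pu s - 1) = u ∨ f (pu s + 1) = u)) := fun s hs is => by
      obtain ⟨⟨p1, -, p3⟩, p4⟩ := hpu s is
      exact ⟨(memT s hs).1, p1, p3, p4⟩
    exact eq_or_eq_of_same_gap (p := pu) (e s hs is) (e t ht it) (e r hr ir) h h'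
  · intro s hs t ht r hr is it ir h h'
    have e : ∀ s ∈ T, Inner head τ b j₀ j₁ w s → (s ≠ w ∧ 0 < pw s ∧ f (pw s) = s ∧
        (f (pw s - 1) = w ∨ f (pw s + 1) = w)) := fun s hs is => by
      obtain ⟨⟨p1, -, p3⟩, p4⟩ := hpw s is
      exact ⟨(memT s hs).2.1, by omega, p3, p4⟩
    exact eq_or_eq_of_same_gap (p := pw) (e s hs is) (e t ht it) (e r hr ir) h h'
  -- All visits to `s` are on the word and within the two ranges. A consecutive visit to `t` is in
  -- the same range and, since neither vertex bounds a gap, in the same gap.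
  · intro s hs t ht is js hst
    rcases hc.word.adj_cases hG hst with h | ⟨e, he, ⟨h3, h4⟩ | ⟨h3, h4⟩⟩
    · obtain ⟨i, hi, j, hjl, his, hjt, hij⟩ := consecutive s hs t ht h
      have hne1 := (memT s hs).1
      have hne2 := (memT s hs).2.1
      have hne3 := (memT t ht).1
      have hne4 := (memT t ht).2.1
      have i1 : i ≠ 0 := by rintro rfl; exact hne1 (his.symm.trans hc.head_zero)
      have i2 : i ≠ i₁ := by rintro rfl; exact hne1 (his.symm.trans hc.head_i₁)
      have i3 : i ≠ j₀ := by rintro rfl; exact hne2 (his.symm.trans hc.head_j₀)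
      have i4 : i ≠ j₁ := by rintro rfl; exact hne2 (his.symm.trans hc.head_j₁)
      have j1 : j ≠ 0 := by rintro rfl; exact hne3 (hjt.symm.trans hc.head_zero)
      have j2 : j ≠ i₁ := by rintro rfl; exact hne3 (hjt.symm.trans hc.head_i₁)
      have j3 : j ≠ j₀ := by rintro rfl; exact hne4 (hjt.symm.trans hc.head_j₀)
      have j4 : j ≠ j₁ := by rintro rfl; exact hne4 (hjt.symm.trans hc.head_j₁)
      rcases hc.lt_or_lt_of_inner_inner is js hi his with h5 | h5
      · left
        have it := innerU t ht j hjl hjt (by omega)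
        refine ⟨it, ?_⟩
        rw [← lastU s hs i (by omega) (by omega) his is, ← lastU t ht j (by omega) (by omega) hjt it]
        exact findGreatest_eq_of_no_between _ (by rwa [his]) (by rwa [hjt]) (fun y _ _ => by omega)
          (fun y _ _ => by omega)
      · right
        have it := innerW t ht j hjl hjt (by omega)
        refine ⟨it, ?_⟩
        rw [← lastW s hs i (by omega) (by omega) his js, ← lastW t ht j (by omega) (by omega) hjt it]
        exact findGreatest_eq_of_no_between _ (by rwa [his]) (by rwa [hjt]) (fun y _ _ => by omega)
          (fun y _ _ => by omega)
    · exact absurd (hc.sameCycle_of_inner_inner is js h3) he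
    · exact absurd (sameCycle_apply_right.1 (hc.sameCycle_of_inner_inner is js h4)) he
  -- On the word `s` is visited only from `j₀` on and `t` only up to `i₁`; off the word `s` is on
  -- the cycle of `xu` and `t` on that of `xw`. So no step joins them.
  · intro s hs t ht is js jt it hst
    have ns := (memT s hs).2.2.1.resolve_left is
    have nt := (memT t ht).2.2.2.resolve_left jt
    obtain ⟨k, ⟨-, -, hks⟩, -⟩ := id js
    obtain ⟨k', ⟨-, -, hkt⟩, -⟩ := id it
    obtain ⟨es, hes, hes'⟩ := ns.exists_sameCycle
    obtain ⟨et, het, het'⟩ := nt.exists_sameCycle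
    have us : ∀ e, ¬ τ.SameCycle b e → head e = s → τ.SameCycle xu e := fun e he h => by
      rwa [hc.eq_of_word he (not_sameCycle_of_sameCycle hc.not_u hes') (hks.trans h.symm) (h.trans hes.symm)]
    have ut : ∀ e, ¬ τ.SameCycle b e → head e = t → τ.SameCycle xw e := fun e he h => by
      rwa [hc.eq_of_word he (not_sameCycle_of_sameCycle hc.not_w het') (hkt.trans h.symm) (h.trans het.symm)]
    rcases hc.word.adj_cases hG hst with h | ⟨e, he, ⟨h3, h4⟩ | ⟨h3, h4⟩⟩
    · obtain ⟨i, hi, j, hjl, his, hjt, hij⟩ := consecutive s hs t ht h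
      have j2 : j ≠ i₁ := by
        rintro rfl; exact (memT t ht).1 (hjt.symm.trans hc.head_i₁)
      have := hc.only_w js ns hi his
      have := hc.only_u it nt hjl hjt
      omega
    · have he' : ¬ τ.SameCycle b (τ e) := fun h' => he (sameCycle_apply_right.1 h')
      exact hc.not_uw ((sameCycle_apply_right.2 (us e he h3)).trans (ut _ he' h4).symm)
    · have he' : ¬ τ.SameCycle b (τ e) := fun h' => he (sameCycle_apply_right.1 h')
      exact hc.not_uw ((us _ he' h4).trans (sameCycle_apply_right.2 (ut e he h3)).symm)

end Config

end DirectedRotation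

/-! ### At most two antifaces. -/

namespace DirectedRotation

variable {A V : Type*} {head : A → V} {c τ : Perm A} {b : A}

/-- A property that passes to adjacent vertices passes to reachable vertices. -/
theorem _root_.SimpleGraph.Reachable.of_adj {V : Type*} {G : SimpleGraph V} {p : V → Prop}
    (h : ∀ u v, G.Adj u v → p u → p v) {u v : V} (huv : G.Reachable u v) (hu : p u) : p v := by
  obtain ⟨w⟩ := huv
  induction w with
  | nil => exact hu
  | cons h' _ ih => exact ih (h _ _ h' hu)

theorem orbitCount_le_two {x y : A} (h : ∀ a, τ.SameCycle x a ∨ τ.SameCycle y a) :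
    τ.orbitCount ≤ 2 := by
  have hs : Function.Surjective fun i : Bool =>
      (Quotient.mk (SameCycle.setoid τ) (if i then x else y)) := by
    intro q
    induction q using Quotient.inductionOn with | _ a
    rcases h a with h | h
    · exact ⟨true, Quotient.sound h⟩
    · exact ⟨false, Quotient.sound h⟩
  have := Nat.card_le_card_of_surjective _ hs
  simpa [orbitCount] using this

variable [Finite A] [DecidableEq A]

/-- The word is made to start at the first visit to `head xu` after a visit to `head xw`; the ban on
linked visits then puts all visits to the former before those to the latter. -/
theorem Optimal.exists_config (h : Optimal head c τ b) {xu xw zu zw : A}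
    (hxu : ¬ τ.SameCycle b xu) (hxw : ¬ τ.SameCycle b xw) (huw : ¬ τ.SameCycle xu xw)
    (hzu : τ.SameCycle b zu) (hzw : τ.SameCycle b zw) (hu : head zu = head xu)
    (hw : head zw = head xw) : ∃ b' l i₁ j₀ j₁, Config head c τ b' l i₁ j₀ j₁ xu xw := by
  classical
  have hne : head xu ≠ head xw := fun h' => huw (by
    rw [h.eq_of_head_eq hzu hxu hxw h' hu])
  -- the first visit to `head xu` after a visit to `head xw`
  have hex : ∃ k, head ((τ ^ k) zw) = head xu := by
    obtain ⟨k, hk⟩ := (hzw.symm.trans hzu).exists_nat_pow_eq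
    exact ⟨k, by rw [hk, hu]⟩
  set k := Nat.find hex with hk
  have hku : head ((τ ^ k) zw) = head xu := Nat.find_spec hex
  have hkmin : ∀ i < k, head ((τ ^ i) zw) ≠ head xu := fun i hi => Nat.find_min hex hi
  have hk0 : k ≠ 0 := by
    intro h0
    rw [h0] at hku
    exact hne (hku.symm.trans hw)
  set b' := (τ ^ k) zw with hb'
  have hbb' : τ.SameCycle b b' := hzw.trans (sameCycle_pow _ _ _)
  have hopt : Optimal head c τ b' := by
    refine ⟨h.1, fun τ' b'' h' => ?_⟩
    have e : ∀ a, τ.SameCycle b' a ↔ τ.SameCycle b a := fun a =>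
      ⟨fun h => hbb'.trans h, fun h => hbb'.symm.trans h⟩
    simp only [e]
    exact h.2 τ' b'' h'
  obtain ⟨l, hl⟩ := exists_isWord τ b'
  obtain ⟨j, hj, hjz⟩ := hl.surj zw (hbb'.symm.trans hzw)
  have h0 : head ((τ ^ 0) b') = head xu := hku
  have hjw : head ((τ ^ j) b') = head xw := by rw [hjz, hw]
  have hxu' : ¬ τ.SameCycle b' xu := fun h' => hxu (hbb'.trans h')
  have hxw' : ¬ τ.SameCycle b' xw := fun h' => hxw (hbb'.trans h')
  -- A visit to `head xu` after position `j` would be reached from `zw` before the return to `b'`,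
  -- against the minimality of `k`.
  have before : ∀ i < l, head ((τ ^ i) b') = head xu → i < j := by
    intro i hi hiu
    by_contra hji
    have hij : i ≠ j := by rintro rfl; exact hne (hiu.symm.trans hjw)
    have e : (τ ^ (i - j)) zw = (τ ^ i) b' := by
      rw [← hjz, ← mul_apply, ← pow_add]
      congr 2
      omega
    have hki : k ≤ i - j := by
      by_contra hlt
      exact hkmin (i - j) (by omega) (by rw [e, hiu])
    have e' : (τ ^ (k + j)) b' = (τ ^ 0) b' := by
      rw [pow_add, mul_apply, hjz, ← hb', pow_zero, one_apply]
    have := hl.inj (k + j) (by omega) 0 hl.pos e'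
    omega
  set Pu : ℕ → Prop := fun i => head ((τ ^ i) b') = head xu with hPu
  set i₁ := Nat.findGreatest Pu (l - 1) with hi₁
  have hi₁u : head ((τ ^ i₁) b') = head xu := Nat.findGreatest_spec (P := Pu) (Nat.zero_le _) h0
  have hi₁l : i₁ < l := by
    have := Nat.findGreatest_le (P := Pu) (l - 1)
    have := hl.pos
    omega
  have hle : ∀ i < l, head ((τ ^ i) b') = head xu → i ≤ i₁ := fun i hi hiu =>
    Nat.le_findGreatest (P := Pu) (by omega) hiu
  have hwpos : ∀ p < l, head ((τ ^ p) b') = head xw → i₁ < p := by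
    intro p hp hpw
    by_contra hlt
    have hp0 : p ≠ 0 := by rintro rfl; exact hne (h0.symm.trans hpw)
    exact h.1.not_linked_word hl hxu' hxw' huw (y := 0) (y' := i₁) (p := p) (q := j) (by omega)
      hi₁l (by omega) (by omega) hj (Or.inr (before i₁ hi₁l hi₁u)) h0 hi₁u hpw hjw
  set Pw : ℕ → Prop := fun i => head ((τ ^ i) b') = head xw with hPw
  have hexw : ∃ i, Pw i := ⟨j, hjw⟩
  have hj₀l : Nat.find hexw < l := (Nat.find_min' hexw hjw).trans_lt hj
  have hj₁w : Pw (Nat.findGreatest Pw (l - 1)) :=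
    Nat.findGreatest_spec (P := Pw) (m := j) (by omega) hjw
  have hj₁l : Nat.findGreatest Pw (l - 1) < l := by
    have := Nat.findGreatest_le (P := Pw) (l - 1)
    have := hl.pos
    omega
  exact ⟨b', l, i₁, Nat.find hexw, Nat.findGreatest Pw (l - 1),
    { opt := hopt
      word := hl
      not_u := hxu'
      not_w := hxw'
      not_uw := huw
      head_zero := h0
      head_i₁ := hi₁u
      head_j₀ := Nat.find_spec hexw
      head_j₁ := hj₁w
      le_i₁ := hle
      j₀_le := fun i _ hi => Nat.find_min' hexw hi
      le_j₁ := fun i hi hiw => Nat.le_findGreatest (P := Pw) (by omega) hiw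
      i₁_lt := hwpos _ hj₀l (Nat.find_spec hexw)
      j₁_lt := hj₁l }⟩

/-- In a connected dense graph the antiface permutation can be chosen with at most two cycles. -/
theorem exists_admissible_orbitCount_le_two [Fintype V] {G : SimpleGraph V} [DecidableRel G.Adj]
    (hG : ∀ u v, G.Adj u v →
      ∃ a, (head (c⁻¹ a) = u ∧ head a = v) ∨ (head (c⁻¹ a) = v ∧ head a = u))
    (hconn : G.Connected) {m : ℕ} (hn : 5 * m + 7 ≤ Fintype.card V)
    (hdeg : ∀ v, Fintype.card V ≤ G.degree v + m + 1) :
    ∃ τ, Admissible head c τ ∧ τ.orbitCount ≤ 2 := by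
  classical
  have hstep : ∀ τ, Admissible head c τ → ∀ u v, G.Adj u v →
      ∃ e, (head e = u ∧ head (τ e) = v) ∨ (head e = v ∧ head (τ e) = u) := by
    intro τ hτ u v huv
    obtain ⟨a, ha⟩ := hG u v huv
    refine ⟨τ.symm a, ?_⟩
    have := hτ.head_apply (τ.symm a)
    rw [apply_symm_apply] at this ⊢
    rwa [← this]
  have config_false : ∀ τ b, Optimal head c τ b → ∀ xu xw zu zw, ¬ τ.SameCycle b xu →
      ¬ τ.SameCycle b xw → ¬ τ.SameCycle xu xw → τ.SameCycle b zu → τ.SameCycle b zw →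
      head zu = head xu → head zw = head xw → False := by
    intro τ b h xu xw zu zw h1 h2 h3 h4 h5 h6 h7
    obtain ⟨_, _, _, _, _, hc⟩ := h.exists_config h1 h2 h3 h4 h5 h6 h7
    exact hc.false_of_dense (hstep τ h.1.1) hn hdeg
  have hne : Nonempty A := by
    obtain ⟨v⟩ := hconn.nonempty
    have h1 := hdeg v
    obtain ⟨w, hw⟩ : ∃ w, G.Adj v w := by
      by_contra hcon
      push Not at hcon
      have : G.degree v = 0 := by
        rw [← G.card_neighborFinset_eq_degree, Finset.card_eq_zero, Finset.eq_empty_iff_forall_notMem]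
        intro w hw
        exact hcon w ((G.mem_neighborFinset v w).1 hw)
      omega
    obtain ⟨a, -⟩ := hG v w hw
    exact ⟨a⟩
  obtain ⟨τ, b, hopt⟩ := exists_optimal head c
  refine ⟨τ, hopt.1.1, ?_⟩
  by_contra hcount
  have third : ∀ x y, ∃ a, ¬ τ.SameCycle x a ∧ ¬ τ.SameCycle y a := by
    intro x y
    by_contra hcon
    push Not at hcon
    exact hcount (orbitCount_le_two fun a => or_iff_not_imp_left.2 (hcon a))
  have hadj := hstep τ hopt.1.1
  -- another cycle meets the largest one
  obtain ⟨z, x, hz, hx, hzx⟩ : ∃ z x, τ.SameCycle b z ∧ ¬ τ.SameCycle b x ∧ head z = head x := by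
    by_contra hcon
    push Not at hcon
    obtain ⟨a, ha, -⟩ := third b b
    have hclosed : ∀ u v, G.Adj u v → (∃ z, τ.SameCycle b z ∧ head z = u) →
        (∃ z, τ.SameCycle b z ∧ head z = v) := by
      rintro u v huv ⟨z, hz, rfl⟩
      obtain ⟨e, ⟨he, he'⟩ | ⟨he, he'⟩⟩ := hadj _ _ huv
      · have : τ.SameCycle b e := by
          by_contra hb
          exact hcon z e hz hb he.symm
        exact ⟨τ e, sameCycle_apply_right.2 this, he'⟩
      · have : τ.SameCycle b (τ e) := by
          by_contra hb
          exact hcon z _ hz hb he'.symm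
        exact ⟨e, sameCycle_apply_right.1 this, he⟩
    obtain ⟨z, hz, hza⟩ := (hconn.preconnected (head b) (head a)).of_adj hclosed
      ⟨b, SameCycle.refl _ _, rfl⟩
    exact hcon z a hz ha hza
  have honly : ∀ x' z', τ.SameCycle b z' → ¬ τ.SameCycle b x' → head z' = head x' →
      τ.SameCycle x x' := by
    intro x' z' hz' hx' h
    by_contra hxx
    exact config_false τ b hopt x x' z z' hx hx' hxx hz hz' hzx h
  -- Only the cycle of `x` meets the largest one, so a third cycle visits no vertex of the largest.
  obtain ⟨a, hba, hxa⟩ := third b x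
  have hav : ∀ z', τ.SameCycle b z' → head z' ≠ head a := fun z' hz' h =>
    hxa (honly a z' hz' hba h)
  set F : Finset V := Finset.univ.filter fun t => ∃ z', τ.SameCycle b z' ∧ head z' = t with hF
  -- The neighbours of `head z` are on the largest cycle, except possibly the two next to `x`, which
  -- is the only visit to `head z` by another cycle.
  have hFcard : Fintype.card V ≤ F.card + m + 3 := by
    have hsub : G.neighborFinset (head z) ⊆ F ∪ {head (τ x), head (τ.symm x)} := by
      intro t ht
      rw [SimpleGraph.mem_neighborFinset] at ht
      rw [Finset.mem_union, Finset.mem_insert, Finset.mem_singleton, hF, Finset.mem_filter]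
      obtain ⟨e, ⟨he, he'⟩ | ⟨he, he'⟩⟩ := hadj _ _ ht
      · by_cases hb : τ.SameCycle b e
        · exact Or.inl ⟨Finset.mem_univ _, τ e, sameCycle_apply_right.2 hb, he'⟩
        · have := hopt.eq_of_head_eq hz hx hb (hzx.symm.trans he.symm) hzx
          subst this
          exact Or.inr (Or.inl he'.symm)
      · by_cases hb : τ.SameCycle b e
        · exact Or.inl ⟨Finset.mem_univ _, e, hb, he⟩
        · have hb' : ¬ τ.SameCycle b (τ e) := fun h => hb (sameCycle_apply_right.1 h)
          have := hopt.eq_of_head_eq hz hx hb' (hzx.symm.trans he'.symm) hzx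
          subst this
          exact Or.inr (Or.inr (by rw [symm_apply_apply]; exact he.symm))
    have h1 := (Finset.card_le_card hsub).trans (Finset.card_union_le _ _)
    have h2 : ({head (τ x), head (τ.symm x)} : Finset V).card ≤ 2 := Finset.card_le_two
    rw [G.card_neighborFinset_eq_degree] at h1
    have := hdeg (head z)
    omega
  have hcommon : 2 < (G.neighborFinset (head a) ∩ F).card := by
    have h1 := Finset.card_union_add_card_inter (G.neighborFinset (head a)) F
    have h2 : G.neighborFinset (head a) ∪ F ⊆ ({head a} : Finset V)ᶜ := by
      intro t
      rw [Finset.mem_union, SimpleGraph.mem_neighborFinset, hF, Finset.mem_filter,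
        Finset.mem_compl, Finset.mem_singleton]
      rintro (h | ⟨-, z', hz', rfl⟩)
      · exact h.ne'
      · exact hav z' hz'
    have h3 := Finset.card_le_card h2
    rw [Finset.card_compl, Finset.card_singleton] at h3
    rw [G.card_neighborFinset_eq_degree] at h1
    have := hdeg (head a)
    omega
  -- two common neighbours are separated by a move at `head a`
  have hmove : ∀ q q' z₁ z₂ y y', τ.SameCycle b z₁ → τ.SameCycle b z₂ → head z₁ = head q →
      head z₂ = head q' → ¬ τ.SameCycle b q → ¬ τ.SameCycle b q' → y ≠ y' → head y = head a →
      head y' = head a → τ.SameCycle y q → τ.SameCycle y' q' →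
      ((τ * swap y y').SameCycle y q ∧ (τ * swap y y').SameCycle y' q' ∨
      (τ * swap y y').SameCycle y q' ∧ (τ * swap y y').SameCycle y' q) → False := by
    intro q q' z₁ z₂ y y' hz₁ hz₂ hq hq' hbq hbq' hne hy hy' hyq hyq' hs
    have hxq := honly q z₁ hz₁ hbq hq
    have hxq' := honly q' z₂ hz₂ hbq' hq'
    have hyy : τ.SameCycle y y' := hyq.trans (hxq.symm.trans (hxq'.trans hyq'.symm))
    have hay : ¬ τ.SameCycle a y := fun h => hxa (hxq.trans (hyq.symm.trans h.symm))
    have hby : ¬ τ.SameCycle y b := fun h => hbq (h.symm.trans hyq)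
    have hab : ¬ τ.SameCycle a b := fun h => hba h.symm
    obtain ⟨τ', hmin, hm⟩ := hopt.1.exists_move (hy.trans hy'.symm) hy.symm hne hyy hay
    have hopt' := hopt.of_move hmin hm hba (fun h => hby h.symm)
    refine config_false τ' b hopt' q q' z₁ z₂ ?_ ?_ ?_ ?_ ?_ hq hq'
    · rwa [hm.sameCycle_iff_of_not hab hby]
    · rwa [hm.sameCycle_iff_of_not hab hby]
    · rw [hm.sameCycle_iff_of_sameCycle hyq (hyy.trans hyq')]
      intro h
      apply not_sameCycle_mul_swap hne hyy
      rcases hs with ⟨h1, h2⟩ | ⟨h1, h2⟩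
      · exact h1.trans (h.trans h2.symm)
      · exact h1.trans (h.symm.trans h2.symm)
    · rwa [hm.sameCycle_iff_of_not hab hby]
    · rwa [hm.sameCycle_iff_of_not hab hby]
  -- The step between `head a` and `t` is off the largest cycle, so it provides a visit `q` to `t`
  -- by another cycle, next to a visit to `head a`.
  have hpq : ∀ t ∈ G.neighborFinset (head a) ∩ F, ∃ q z', τ.SameCycle b z' ∧ head z' = head q ∧
      head q = t ∧ ¬ τ.SameCycle b q ∧ (head (τ.symm q) = head a ∨ head (τ q) = head a) := by
    intro t ht
    rw [Finset.mem_inter, SimpleGraph.mem_neighborFinset, hF, Finset.mem_filter] at ht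
    obtain ⟨hat, -, z', hz', hzt⟩ := ht
    obtain ⟨e, ⟨he, he'⟩ | ⟨he, he'⟩⟩ := hadj _ _ hat
    · refine ⟨τ e, z', hz', hzt.trans he'.symm, he', fun h => ?_, Or.inl ?_⟩
      · exact hav e (sameCycle_apply_right.1 h) he
      · rwa [symm_apply_apply]
    · exact ⟨e, z', hz', hzt.trans he.symm, he, fun h =>
        hav (τ e) (sameCycle_apply_right.2 h) he', Or.inr he'⟩
  have hplus : ∀ q q' z₁ z₂, τ.SameCycle b z₁ → τ.SameCycle b z₂ → head z₁ = head q →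
      head z₂ = head q' → ¬ τ.SameCycle b q → ¬ τ.SameCycle b q' → head q ≠ head q' →
      head (τ.symm q) = head a → head (τ.symm q') = head a → False := by
    intro q q' z₁ z₂ h1 h2 h3 h4 h5 h6 hne h7 h8
    refine hmove q q' z₁ z₂ (τ.symm q) (τ.symm q') h1 h2 h3 h4 h5 h6 ?_ h7 h8
      (sameCycle_symm_apply_left.2 (SameCycle.refl _ _))
      (sameCycle_symm_apply_left.2 (SameCycle.refl _ _)) (Or.inr ⟨?_, ?_⟩)
    · intro h
      exact hne (congrArg head (τ.symm.injective h))
    · have := sameCycle_apply_self (τ * swap (τ.symm q) (τ.symm q')) (τ.symm q)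
      rwa [mul_apply, swap_apply_left, apply_symm_apply] at this
    · have := sameCycle_apply_self (τ * swap (τ.symm q) (τ.symm q')) (τ.symm q')
      rwa [mul_apply, swap_apply_right, apply_symm_apply] at this
  have hminus : ∀ q q' z₁ z₂, τ.SameCycle b z₁ → τ.SameCycle b z₂ → head z₁ = head q →
      head z₂ = head q' → ¬ τ.SameCycle b q → ¬ τ.SameCycle b q' → head q ≠ head q' →
      head (τ q) = head a → head (τ q') = head a → False := by
    intro q q' z₁ z₂ h1 h2 h3 h4 h5 h6 hne h7 h8
    have n1 : ∀ y, head y = head a → q ≠ y := by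
      rintro _ h rfl
      exact hav z₁ h1 (h3.trans h)
    have n2 : ∀ y, head y = head a → q' ≠ y := by
      rintro _ h rfl
      exact hav z₂ h2 (h4.trans h)
    refine hmove q q' z₁ z₂ (τ q) (τ q') h1 h2 h3 h4 h5 h6 ?_ h7 h8
      (sameCycle_apply_self _ _).symm (sameCycle_apply_self _ _).symm (Or.inl ⟨?_, ?_⟩)
    · intro h
      exact hne (congrArg head (τ.injective h))
    · have := sameCycle_apply_self (τ * swap (τ q) (τ q')) q
      rw [mul_apply, swap_apply_of_ne_of_ne (n1 _ h7) (n1 _ h8)] at this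
      exact this.symm
    · have := sameCycle_apply_self (τ * swap (τ q) (τ q')) q'
      rw [mul_apply, swap_apply_of_ne_of_ne (n2 _ h7) (n2 _ h8)] at this
      exact this.symm
  -- Of three such visits two are on the same side of `head a`: both come right after it or both
  -- right before it.
  obtain ⟨t₁, t₂, t₃, ht₁, ht₂, ht₃, h12, h13, h23⟩ := Finset.two_lt_card_iff.1 hcommon
  obtain ⟨q₁, z₁, a1, a2, rfl, a3, a4⟩ := hpq t₁ ht₁
  obtain ⟨q₂, z₂, b1, b2, rfl, b3, b4⟩ := hpq t₂ ht₂
  obtain ⟨q₃, z₃, c1, c2, rfl, c3, c4⟩ := hpq t₃ ht₃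
  rcases a4 with a4 | a4 <;> rcases b4 with b4 | b4 <;> rcases c4 with c4 | c4
  · exact hplus q₁ q₂ z₁ z₂ a1 b1 a2 b2 a3 b3 h12 a4 b4
  · exact hplus q₁ q₂ z₁ z₂ a1 b1 a2 b2 a3 b3 h12 a4 b4
  · exact hplus q₁ q₃ z₁ z₃ a1 c1 a2 c2 a3 c3 h13 a4 c4
  · exact hminus q₂ q₃ z₂ z₃ b1 c1 b2 c2 b3 c3 h23 b4 c4
  · exact hplus q₂ q₃ z₂ z₃ b1 c1 b2 c2 b3 c3 h23 b4 c4
  · exact hminus q₁ q₃ z₁ z₃ a1 c1 a2 c2 a3 c3 h13 a4 c4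
  · exact hminus q₁ q₂ z₁ z₂ a1 b1 a2 b2 a3 b3 h12 a4 b4
  · exact hminus q₁ q₂ z₁ z₂ a1 b1 a2 b2 a3 b3 h12 a4 b4

end DirectedRotation

/-! ### Cyclic sequences and the permutations that follow them. -/

namespace Cycle

variable {A : Type*}

theorem chain_iff_next [DecidableEq A] {r : A → A → Prop} {c : Cycle A} (hc : c.Nodup) :
    c.Chain r ↔ ∀ a (ha : a ∈ c), r a (c.next hc a ha) := by
  induction c using Quotient.inductionOn with | _ l
  have hl : l.Nodup := hc
  rcases l with - | ⟨x, l⟩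
  · simp
  · change List.IsChain r (x :: (l ++ [x])) ↔ ∀ a (ha : a ∈ x :: l), r a ((x :: l).next a ha)
    rw [List.isChain_iff_getElem]
    have hlen : (x :: (l ++ [x])).length = l.length + 2 := by simp
    have e1 : ∀ i (hi : i < (x :: l).length), (x :: (l ++ [x]))[i]'(by simp at hi ⊢; omega) =
        (x :: l)[i] := by
      intro i hi
      rw [← List.cons_append] at *
      exact List.getElem_append_left hi
    have e2 : ∀ i (hi : i < (x :: l).length), (x :: (l ++ [x]))[i + 1]'(by simp at hi ⊢; omega) =
        (x :: l)[(i + 1) % (x :: l).length]'(Nat.mod_lt _ (by simp)) := by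
      intro i hi
      rcases Nat.lt_or_ge (i + 1) (x :: l).length with h | h
      · rw [e1 _ h]
        congr 1
        exact (Nat.mod_eq_of_lt h).symm
      · have hi' : i + 1 = (x :: l).length := by omega
        have hil : i = l.length := by simpa using hi'
        subst hil
        simp
    constructor
    · intro h a ha
      obtain ⟨i, hi, rfl⟩ := List.getElem_of_mem ha
      rw [List.next_getElem _ hl i hi, ← e2 i hi, ← e1 i hi]
      exact h i _
    · intro h i hi
      have hi' : i < (x :: l).length := by
        rw [hlen] at hi
        simp
        omega
      have := h ((x :: l)[i]) (List.getElem_mem hi')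
      rw [List.next_getElem _ hl i hi', ← e2 i hi', ← e1 i hi'] at this
      exact this

theorem chain_reverse {r : A → A → Prop} {c : Cycle A} :
    c.reverse.Chain r ↔ c.Chain fun a b => r b a := by
  induction c using Quotient.inductionOn with | _ l
  rcases l with - | ⟨x, l⟩
  · exact Iff.rfl
  · change Chain r (reverse ((x :: l : List A) : Cycle A)) ↔
      Chain (fun a b => r b a) ((x :: l : List A) : Cycle A)
    rw [Cycle.reverse_coe, List.reverse_cons, ← Cycle.coe_cons_eq_coe_append,
      Cycle.chain_coe_cons, Cycle.chain_coe_cons, ← List.isChain_reverse]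
    simp

theorem nodup_map {B : Type*} {f : A → B} (hf : Function.Injective f) {c : Cycle A}
    (hc : c.Nodup) : (c.map f).Nodup := by
  induction c using Quotient.inductionOn with | _ l
  exact List.Nodup.map hf hc

theorem exists_mem_of_ne_nil {c : Cycle A} (hc : c ≠ nil) : ∃ a, a ∈ c := by
  induction c using Quotient.inductionOn with | _ l
  rcases l with - | ⟨x, l⟩
  · exact absurd rfl hc
  · exact ⟨x, List.mem_cons_self⟩

end Cycle

namespace Equiv.Perm

variable {A : Type*}

/-- The permutation `σ` maps each member of the cyclic sequence `c` to the next one. -/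
def Follows (σ : Perm A) (c : Cycle A) : Prop := c.Chain fun a b => σ a = b

theorem follows_iff [DecidableEq A] {σ : Perm A} {c : Cycle A} (hc : c.Nodup) :
    σ.Follows c ↔ ∀ a ∈ c, σ a = c.formPerm hc a := by
  rw [Follows, Cycle.chain_iff_next hc]
  exact forall₂_congr fun a ha => by rw [Cycle.formPerm_apply_mem_eq_next c hc a ha]

theorem Follows.sameCycle {σ : Perm A} {c : Cycle A} (h : σ.Follows c) {a b : A} (ha : a ∈ c)
    (hb : b ∈ c) : σ.SameCycle a b := by
  have : IsTrans A σ.SameCycle := ⟨fun _ _ _ => SameCycle.trans⟩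
  have h' : c.Chain σ.SameCycle := Cycle.Chain.imp
    (fun a b (hab : σ a = b) => hab ▸ sameCycle_apply_self σ a) h
  exact Cycle.chain_iff_pairwise.1 h' a ha b hb

theorem Follows.mem_of_sameCycle [Finite A] {σ : Perm A} {c : Cycle A} (hc : c.Nodup)
    (h : σ.Follows c) {a b : A} (ha : a ∈ c) (hab : σ.SameCycle a b) : b ∈ c := by
  classical
  refine hab.mem_of_forall_mem (p := (· ∈ c)) (fun x hx => ?_) ha
  rw [(Cycle.chain_iff_next hc).1 h x hx]
  exact Cycle.next_mem _ _ _ _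

end Equiv.Perm

/-! ### Extending disjoint circuits to a circuit decomposition. -/

namespace MDigraph

variable {V A : Type*} {D : MDigraph V A}

/-- A permutation of the arcs all of whose cycles are directed circuits. -/
def IsTransition (D : MDigraph V A) (σ : Perm A) : Prop := ∀ a, D.head a = D.tail (σ a)

theorem IsTransition.mul_swap [DecidableEq A] {σ : Perm A} (h : D.IsTransition σ) {a b : A}
    (hab : D.head a = D.head b) : D.IsTransition (σ * swap a b) := by
  intro e
  rw [mul_apply, ← h]
  rcases eq_or_ne e a with rfl | hea
  · rw [swap_apply_left, hab]
  rcases eq_or_ne e b with rfl | heb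
  · rw [swap_apply_right, hab]
  · rw [swap_apply_of_ne_of_ne hea heb]

/-- The arcs entering each vertex are matched with those leaving it. -/
theorem exists_isTransition [Finite A]
    (h : ∀ v, {a | D.head a = v}.ncard = {a | D.tail a = v}.ncard) :
    ∃ σ, D.IsTransition σ := by
  have e : ∀ v, Nonempty ({a // D.head a = v} ≃ {a // D.tail a = v}) := fun v =>
    Finite.card_eq.1 (h v)
  let σ : A ≃ A := (Equiv.sigmaFiberEquiv D.head).symm.trans
    ((Equiv.sigmaCongrRight fun v => (e v).some).trans (Equiv.sigmaFiberEquiv D.tail))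
  refine ⟨σ, fun a => ?_⟩
  exact ((e (D.head a)).some ⟨a, rfl⟩).2.symm

theorem IsCircuit.head_eq [DecidableEq A] {c : Cycle A} (hc : D.IsCircuit c) {a : A}
    (ha : a ∈ c) : D.head a = D.tail (c.formPerm hc.2.1 a) := by
  rw [Cycle.formPerm_apply_mem_eq_next c hc.2.1 a ha]
  exact (Cycle.chain_iff_next hc.2.1).1 hc.2.2 a ha

variable {C : Finset (Cycle A)}

/-- Disjoint circuits of an eulerian digraph extend to a decomposition into circuits. -/
theorem exists_isTransition_follows [Finite A]
    (h : ∀ v, {a | D.head a = v}.ncard = {a | D.tail a = v}.ncard)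
    (hC : ∀ c ∈ C, D.IsCircuit c) (hdisj : ArcDisjoint C) :
    ∃ σ, D.IsTransition σ ∧ ∀ c ∈ C, σ.Follows c := by
  classical
  -- The number of arcs with the prescribed successor is maximised; arcs on no circuit satisfy the
  -- condition vacuously.
  let good : Perm A → Set A := fun σ =>
    {a | ∀ c (hc : c ∈ C), a ∈ c → σ a = c.formPerm (hC c hc).2.1 a}
  obtain ⟨σ₀, h₀⟩ := exists_isTransition h
  obtain ⟨σ, hσ, hmax⟩ := Set.exists_max_image {σ | D.IsTransition σ}
    (fun σ => (good σ).ncard) (Set.toFinite _) ⟨σ₀, h₀⟩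
  refine ⟨σ, hσ, fun c hc => (follows_iff (hC c hc).2.1).2 fun a ha => ?_⟩
  by_contra hne
  set t := c.formPerm (hC c hc).2.1 a with ht
  have htc : t ∈ c := by
    rw [ht, Cycle.formPerm_apply_mem_eq_next c (hC c hc).2.1 a ha]
    exact Cycle.next_mem _ _ _ _
  set b := σ.symm t with hb
  have hσb : σ b = t := σ.apply_symm_apply t
  have hab : D.head a = D.head b := by
    rw [(hC c hc).head_eq ha, hσ b, hσb]
  have huniq : ∀ c' ∈ C, ∀ e, e ∈ c → e ∈ c' → c' = c := by
    intro c' hc' e he he'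
    by_contra hcc
    exact hdisj c' hc' c hc hcc e he' he
  have hlt : (good σ).ncard < (good (σ * swap a b)).ncard := by
    refine Set.ncard_lt_ncard ((Set.ssubset_iff_of_subset ?_).2 ⟨a, ?_, ?_⟩) (Set.toFinite _)
    · intro e he c' hc' hec'
      have hea : e ≠ a := by
        rintro rfl
        exact hne (he c hc ha)
      -- If `b` is on a circuit it cannot already be correct: its image `t` would identify the
      -- circuit as `c` and `b` as `a`.
      rcases eq_or_ne e b with rfl | heb
      · exfalso
        have h1 := he c' hc' hec'
        rw [hσb] at h1
        have h2 : t ∈ c' := by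
          rw [h1, Cycle.formPerm_apply_mem_eq_next c' (hC c' hc').2.1 _ hec']
          exact Cycle.next_mem _ _ _ _
        have h3 := huniq c' hc' t htc h2
        subst h3
        exact hea ((c'.formPerm (hC c' hc').2.1).injective (h1.symm.trans ht))
      · rw [mul_apply, swap_apply_of_ne_of_ne hea heb]
        exact he c' hc' hec'
    · intro c' hc' hac'
      have h3 := huniq c' hc' a ha hac'
      subst h3
      rw [mul_apply, swap_apply_left, hσb]
    · intro h'
      exact hne (h' c hc ha)
  exact absurd (hmax _ (hσ.mul_swap hab)) (by simpa using hlt)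

section Count

variable {σ : Perm A}

/-- The component of `D - A(C)` that contains the tail of an arc. -/
def tailComponent (D : MDigraph V A) (C : Finset (Cycle A)) (a : A) :
    (D.deleteArcs (usedArcs C)).usg.ConnectedComponent :=
  (D.deleteArcs (usedArcs C)).usg.connectedComponentMk (D.tail a)

theorem reachable_of_notMem {a : A} (ha : a ∉ usedArcs C) :
    (D.deleteArcs (usedArcs C)).usg.Reachable (D.tail a) (D.head a) := by
  rcases eq_or_ne (D.tail a) (D.head a) with h | h
  · rw [h]
  · refine SimpleGraph.Adj.reachable ?_
    exact (SimpleGraph.fromRel_adj _ _ _).2 ⟨h, Or.inl ⟨⟨a, ha⟩, rfl, rfl⟩⟩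

theorem card_add_alpha [Finite V] (D : MDigraph V A) (C : Finset (Cycle A)) : C.card + D.alpha C =
    Nat.card ({c // c ∈ C} ⊕ {K : (D.deleteArcs (usedArcs C)).usg.ConnectedComponent //
        ∃ a, (D.deleteArcs (usedArcs C)).usg.connectedComponentMk
          ((D.deleteArcs (usedArcs C)).tail a) = K}) := by
  rw [Nat.card_sum, alpha, numNontrivialComponents]
  congr 1
  simp

variable [Finite A]

theorem mem_usedArcs_iff_of_sameCycle (hC : ∀ c ∈ C, D.IsCircuit c) (hf : ∀ c ∈ C, σ.Follows c)
    {a b : A} (hab : σ.SameCycle a b) : a ∈ usedArcs C ↔ b ∈ usedArcs C := by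
  constructor
  · rintro ⟨c, hc, ha⟩
    exact ⟨c, hc, (hf c hc).mem_of_sameCycle (hC c hc).2.1 ha hab⟩
  · rintro ⟨c, hc, hb⟩
    exact ⟨c, hc, (hf c hc).mem_of_sameCycle (hC c hc).2.1 hb hab.symm⟩

theorem tailComponent_eq_of_sameCycle (hσ : D.IsTransition σ) (hC : ∀ c ∈ C, D.IsCircuit c)
    (hf : ∀ c ∈ C, σ.Follows c) {a b : A} (hab : σ.SameCycle a b) (ha : a ∉ usedArcs C) :
    D.tailComponent C a = D.tailComponent C b := by
  refine (hab.mem_of_forall_mem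
    (p := fun e => e ∉ usedArcs C ∧ D.tailComponent C a = D.tailComponent C e) ?_ ⟨ha, rfl⟩).2
  rintro e ⟨he, he'⟩
  refine ⟨fun h => he ((mem_usedArcs_iff_of_sameCycle hC hf (sameCycle_apply_self σ e)).2 h), ?_⟩
  rw [he', tailComponent, tailComponent, SimpleGraph.ConnectedComponent.eq, ← hσ e]
  exact reachable_of_notMem he

/-- One cycle of `σ` for each circuit and for each nontrivial component of the rest. -/
theorem exists_cycleMap (hσ : D.IsTransition σ) (hC : ∀ c ∈ C, D.IsCircuit c)
    (hdisj : ArcDisjoint C) (hf : ∀ c ∈ C, σ.Follows c) :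
    ∃ g : ({c // c ∈ C} ⊕ {K : (D.deleteArcs (usedArcs C)).usg.ConnectedComponent //
        ∃ a, (D.deleteArcs (usedArcs C)).usg.connectedComponentMk
          ((D.deleteArcs (usedArcs C)).tail a) = K}) → Quotient (SameCycle.setoid σ),
      Function.Injective g ∧
      (∀ c a, a ∈ c.1 → g (Sum.inl c) = Quotient.mk _ a) ∧
      (∀ K, ∃ a, a ∉ usedArcs C ∧ D.tailComponent C a = K.1 ∧ g (Sum.inr K) = Quotient.mk _ a) := by
  choose p hp using fun c : {c // c ∈ C} => Cycle.exists_mem_of_ne_nil (hC c.1 c.2).1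
  choose q hq using fun K : {K : (D.deleteArcs (usedArcs C)).usg.ConnectedComponent //
        ∃ a, (D.deleteArcs (usedArcs C)).usg.connectedComponentMk
          ((D.deleteArcs (usedArcs C)).tail a) = K} => K.2
  have hq' : ∀ K, D.tailComponent C (q K).1 = K.1 := hq
  refine ⟨Sum.elim (fun c => Quotient.mk _ (p c)) (fun K => Quotient.mk _ (q K).1), ?_, ?_, ?_⟩
  · rintro (c | K) (c' | K') h
    · have hs : σ.SameCycle (p c) (p c') := Quotient.exact h
      have hm := (hf c.1 c.2).mem_of_sameCycle (hC c.1 c.2).2.1 (hp c) hs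
      by_contra hne
      exact hdisj c.1 c.2 c'.1 c'.2 (fun h => hne (by rw [Subtype.ext h])) _ hm (hp c')
    · have hs : σ.SameCycle (p c) (q K').1 := Quotient.exact h
      exact absurd ((mem_usedArcs_iff_of_sameCycle hC hf hs).1 ⟨c.1, c.2, hp c⟩) (q K').2
    · have hs : σ.SameCycle (q K).1 (p c') := Quotient.exact h
      exact absurd ((mem_usedArcs_iff_of_sameCycle hC hf hs).2 ⟨c'.1, c'.2, hp c'⟩) (q K).2
    · have hs : σ.SameCycle (q K).1 (q K').1 := Quotient.exact h
      have := tailComponent_eq_of_sameCycle hσ hC hf hs (q K).2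
      rw [hq', hq'] at this
      rw [Subtype.ext this]
  · intro c a ha
    exact Quotient.sound ((hf c.1 c.2).sameCycle (hp c) ha)
  · intro K
    exact ⟨_, (q K).2, hq' K, rfl⟩

variable [Finite V]

/-- Each circuit is a cycle of `σ`, and any other cycle stays within one component of the remaining
arcs, so every nontrivial component needs a cycle of its own. -/
theorem card_add_alpha_le (hσ : D.IsTransition σ) (hC : ∀ c ∈ C, D.IsCircuit c)
    (hdisj : ArcDisjoint C) (hf : ∀ c ∈ C, σ.Follows c) :
    C.card + D.alpha C ≤ σ.orbitCount := by
  obtain ⟨g, hg, -⟩ := exists_cycleMap hσ hC hdisj hf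
  rw [card_add_alpha]
  exact Nat.card_le_card_of_injective g hg

/-- The remaining arcs can be decomposed into one circuit per nontrivial component. -/
theorem exists_isTransition_orbitCount_eq
    (h : ∀ v, {a | D.head a = v}.ncard = {a | D.tail a = v}.ncard)
    (hC : ∀ c ∈ C, D.IsCircuit c) (hdisj : ArcDisjoint C) :
    ∃ σ, D.IsTransition σ ∧ (∀ c ∈ C, σ.Follows c) ∧ σ.orbitCount = C.card + D.alpha C := by
  classical
  obtain ⟨σ, ⟨hσ, hf⟩, hmin⟩ := DirectedRotation.exists_min_orbitCount
    (exists_isTransition_follows h hC hdisj)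
  refine ⟨σ, hσ, hf, ?_⟩
  -- Otherwise the two cycles could be merged at these unused arcs without disturbing any circuit.
  have sameHead : ∀ a b, a ∉ usedArcs C → b ∉ usedArcs C → D.head a = D.head b →
      σ.SameCycle a b := by
    intro a b ha hb hab
    by_contra hs
    have h1 := orbitCount_mul_swap_add_one hs
    have h2 := hmin (σ * swap a b) ⟨hσ.mul_swap hab, fun c hc => by
      rw [follows_iff (hC c hc).2.1]
      intro e he
      have hea : e ≠ a := by rintro rfl; exact ha ⟨c, hc, he⟩
      have heb : e ≠ b := by rintro rfl; exact hb ⟨c, hc, he⟩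
      rw [mul_apply, swap_apply_of_ne_of_ne hea heb]
      exact (follows_iff (hC c hc).2.1).1 (hf c hc) e he⟩
    omega
  have used_symm : ∀ a, a ∉ usedArcs C → σ.symm a ∉ usedArcs C := fun a ha h' => ha
    ((mem_usedArcs_iff_of_sameCycle hC hf (sameCycle_symm_apply_left.2 (SameCycle.refl σ a))).1 h')
  have used_apply : ∀ a, a ∉ usedArcs C → σ a ∉ usedArcs C := fun a ha h' => ha
    ((mem_usedArcs_iff_of_sameCycle hC hf (sameCycle_apply_self σ a)).2 h')
  have sameTail : ∀ a b, a ∉ usedArcs C → b ∉ usedArcs C → D.tail a = D.tail b →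
      σ.SameCycle a b := by
    intro a b ha hb hab
    have := sameHead _ _ (used_symm a ha) (used_symm b hb)
      (by rw [hσ, hσ, apply_symm_apply, apply_symm_apply, hab])
    rwa [sameCycle_symm_apply_left, sameCycle_symm_apply_right] at this
  have same : ∀ a b, a ∉ usedArcs C → b ∉ usedArcs C →
      D.tailComponent C a = D.tailComponent C b → σ.SameCycle a b := by
    intro a b ha hb hab
    have hr := SimpleGraph.ConnectedComponent.exact hab
    -- The property carried along the component is that all unused arcs leaving the vertex are in
    -- the cycle of `a`.
    refine hr.of_adj (p := fun v => ∀ e, e ∉ usedArcs C → D.tail e = v → σ.SameCycle a e)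
      ?_ (fun e he h => sameTail a e ha he h.symm) b hb rfl
    intro u v huv hu e he hev
    obtain ⟨-, ⟨⟨x, hx⟩, h1, h2⟩ | ⟨⟨x, hx⟩, h1, h2⟩⟩ := (SimpleGraph.fromRel_adj _ _ _).1 huv
    · have h1' : D.tail x = u := h1
      have h2' : D.head x = v := h2
      have h3 := sameTail (σ x) e (used_apply x hx) he (by rw [← hσ, h2', hev])
      exact (hu x hx h1').trans (sameCycle_apply_left.1 h3)
    · have h1' : D.tail x = v := h1
      have h2' : D.head x = u := h2
      have h3 := hu (σ x) (used_apply x hx) (by rw [← hσ, h2'])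
      exact (sameCycle_apply_right.1 h3).trans (sameTail x e hx he (by rw [h1', hev]))
  refine le_antisymm ?_ (card_add_alpha_le hσ hC hdisj hf)
  obtain ⟨g, -, hg1, hg2⟩ := exists_cycleMap hσ hC hdisj hf
  rw [card_add_alpha]
  refine Nat.card_le_card_of_surjective g fun q => ?_
  induction q using Quotient.inductionOn with | _ a
  by_cases ha : a ∈ usedArcs C
  · obtain ⟨c, hc, hac⟩ := ha
    exact ⟨Sum.inl ⟨c, hc⟩, hg1 ⟨c, hc⟩ a hac⟩
  · let K : {K : (D.deleteArcs (usedArcs C)).usg.ConnectedComponent //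
        ∃ a, (D.deleteArcs (usedArcs C)).usg.connectedComponentMk
          ((D.deleteArcs (usedArcs C)).tail a) = K} := ⟨D.tailComponent C a, ⟨a, ha⟩, rfl⟩
    obtain ⟨e, he, hK, hge⟩ := hg2 K
    exact ⟨Sum.inr K, hge.trans (Quotient.sound (same e a he ha hK))⟩

end Count

end MDigraph

/-! ### Directed embeddings as pairs of permutations. -/

namespace MDigraph

variable {V A : Type*} {D : MDigraph V A}

namespace OrientedEmbedding

/-- The profaces of `Φ` are the cycles of `σ` and its antifaces those of `τ`. -/
structure Encodes (Φ : D.OrientedEmbedding) (σ τ : Perm A) : Prop where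
  inl : ∀ a, Φ.faceNext (Sum.inl a) = Sum.inl (σ a)
  inr : ∀ a, Φ.faceNext (Sum.inr (τ a)) = Sum.inr a

variable {Φ : D.OrientedEmbedding}

theorem faceOf_eq_iff {d e : A ⊕ A} :
    Φ.faceOf d = Φ.faceOf e ↔ Φ.faceNext.SameCycle d e :=
  ⟨fun h => Quotient.exact h, fun h => Quotient.sound h⟩

theorem faceOf_faceNext (d : A ⊕ A) : Φ.faceOf (Φ.faceNext d) = Φ.faceOf d :=
  (faceOf_eq_iff.2 (sameCycle_apply_self _ d)).symm

theorem inc_faceNext (d : A ⊕ A) : D.inc (Φ.faceNext d) = D.inc d.swap := by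
  have := Φ.inc_rot (Φ.rot.symm d.swap)
  rw [apply_symm_apply] at this
  exact this.symm

/-- In a directed embedding face tracing preserves each of the two kinds of half-arcs, so it
restricts to two permutations of the arcs. -/
theorem IsDirected.exists_encodes [Finite A] (h : Φ.IsDirected) : ∃ σ τ, Φ.Encodes σ τ := by
  have h1 : ∀ a, ∃ b, Φ.faceNext (Sum.inl a) = Sum.inl b := by
    intro a
    rcases h (Φ.faceOf (Sum.inl a)) with hf | hf
    · exact hf _ (faceOf_faceNext _)
    · obtain ⟨b, hb⟩ := hf _ rfl
      cases hb
  have h2 : ∀ a, ∃ b, Φ.faceNext (Sum.inr a) = Sum.inr b := by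
    intro a
    rcases h (Φ.faceOf (Sum.inr a)) with hf | hf
    · obtain ⟨b, hb⟩ := hf _ rfl
      cases hb
    · exact hf _ (faceOf_faceNext _)
  choose s hs using h1
  choose t ht using h2
  have hsi : Function.Injective s := fun a b hab =>
    Sum.inl_injective (Φ.faceNext.injective (by rw [hs, hs, hab]))
  have hti : Function.Injective t := fun a b hab =>
    Sum.inr_injective (Φ.faceNext.injective (by rw [ht, ht, hab]))
  let σ := Equiv.ofBijective s (Finite.injective_iff_bijective.1 hsi)
  let τ := Equiv.ofBijective t (Finite.injective_iff_bijective.1 hti)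
  -- Clockwise tracing follows antifaces against their arcs, hence the inverse.
  refine ⟨σ, τ.symm, hs, fun a => ?_⟩
  rw [ht]
  exact congrArg Sum.inr (τ.apply_symm_apply a)

namespace Encodes

variable {σ τ : Perm A} (h : Φ.Encodes σ τ)
include h

theorem isTransition_left : D.IsTransition σ := by
  intro a
  have := inc_faceNext (Φ := Φ) (Sum.inl a)
  rw [h.inl] at this
  exact this.symm

theorem isTransition_right : D.IsTransition τ := by
  intro a
  have := inc_faceNext (Φ := Φ) (Sum.inr (τ a))
  rw [h.inr] at this
  exact this

theorem follows_of_boundsProface {c : Cycle A} (hc : Φ.BoundsProface c) : σ.Follows c := by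
  obtain ⟨f, -, -, hf⟩ := hc
  rw [Cycle.chain_map] at hf
  refine Cycle.Chain.imp (fun a b hab => ?_) hf
  rw [h.inl] at hab
  exact Sum.inl_injective hab

theorem follows_of_boundsAntiface {c : Cycle A} (hc : Φ.BoundsAntiface c) : τ.Follows c := by
  obtain ⟨f, -, -, hf⟩ := hc
  rw [Cycle.chain_reverse, Cycle.chain_map] at hf
  refine Cycle.Chain.imp (fun a b hab => ?_) hf
  rw [← h.inr a] at hab
  exact (Sum.inr_injective (Φ.faceNext.injective hab)).symm

variable [Finite A]

theorem sameCycle_inl {a : A} {d : A ⊕ A} :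
    Φ.faceNext.SameCycle (Sum.inl a) d ↔ ∃ b, d = Sum.inl b ∧ σ.SameCycle a b := by
  constructor
  · intro hs
    refine hs.mem_of_forall_mem (p := fun d => ∃ b, d = Sum.inl b ∧ σ.SameCycle a b) ?_
      ⟨a, rfl, SameCycle.refl _ _⟩
    rintro _ ⟨b, rfl, hb⟩
    exact ⟨σ b, h.inl b, sameCycle_apply_right.2 hb⟩
  · rintro ⟨b, rfl, hb⟩
    refine hb.mem_of_forall_mem (p := fun b => Φ.faceNext.SameCycle (Sum.inl a) (Sum.inl b)) ?_
      (SameCycle.refl _ _)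
    intro b hb
    rw [← h.inl]
    exact sameCycle_apply_right.2 hb

theorem sameCycle_inr {a : A} {d : A ⊕ A} :
    Φ.faceNext.SameCycle (Sum.inr a) d ↔ ∃ b, d = Sum.inr b ∧ τ.SameCycle a b := by
  constructor
  · intro hs
    refine hs.mem_of_forall_mem (p := fun d => ∃ b, d = Sum.inr b ∧ τ.SameCycle a b) ?_
      ⟨a, rfl, SameCycle.refl _ _⟩
    rintro _ ⟨b, rfl, hb⟩
    refine ⟨τ.symm b, ?_, sameCycle_symm_apply_right.2 hb⟩
    have := h.inr (τ.symm b)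
    rwa [apply_symm_apply] at this
  · rintro ⟨b, rfl, hb⟩
    refine hb.mem_of_forall_mem (p := fun b => Φ.faceNext.SameCycle (Sum.inr a) (Sum.inr b)) ?_
      (SameCycle.refl _ _)
    intro b hb
    rw [← sameCycle_apply_right, h.inr]
    exact hb

theorem isProface_inl (a : A) : Φ.IsProface (Φ.faceOf (Sum.inl a)) := by
  intro d hd
  obtain ⟨b, hb, -⟩ := h.sameCycle_inl.1 (faceOf_eq_iff.1 hd.symm)
  exact ⟨b, hb⟩

theorem isAntiface_inr (a : A) : Φ.IsAntiface (Φ.faceOf (Sum.inr a)) := by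
  intro d hd
  obtain ⟨b, hb, -⟩ := h.sameCycle_inr.1 (faceOf_eq_iff.1 hd.symm)
  exact ⟨b, hb⟩

theorem isDirected : Φ.IsDirected := by
  intro f
  induction f using Quotient.inductionOn with | _ d
  rcases d with a | a
  · exact Or.inl (h.isProface_inl a)
  · exact Or.inr (h.isAntiface_inr a)

theorem boundsProface {c : Cycle A} (hc : D.IsCircuit c) (hf : σ.Follows c) :
    Φ.BoundsProface c := by
  obtain ⟨a, ha⟩ := Cycle.exists_mem_of_ne_nil hc.1
  refine ⟨Φ.faceOf (Sum.inl a), Cycle.nodup_map Sum.inl_injective hc.2.1, fun d => ?_, ?_⟩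
  · rw [Cycle.mem_map, eq_comm, faceOf_eq_iff, h.sameCycle_inl]
    constructor
    · rintro ⟨b, hb, rfl⟩
      exact ⟨b, rfl, hf.sameCycle ha hb⟩
    · rintro ⟨b, rfl, hb⟩
      exact ⟨b, hf.mem_of_sameCycle hc.2.1 ha hb, rfl⟩
  · rw [Cycle.chain_map]
    refine Cycle.Chain.imp (fun a b (hab : σ a = b) => ?_) hf
    rw [h.inl, hab]

theorem numProfaces_eq : Φ.numProfaces = σ.orbitCount := by
  let g : Quotient (SameCycle.setoid σ) → {f : Φ.Face // Φ.IsProface f} :=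
    Quotient.lift (fun a => ⟨Φ.faceOf (Sum.inl a), h.isProface_inl a⟩) fun a b hab =>
      Subtype.ext (faceOf_eq_iff.2 (h.sameCycle_inl.2 ⟨b, rfl, hab⟩))
  refine (Nat.card_congr (Equiv.ofBijective g ⟨?_, ?_⟩)).symm
  · intro q r hqr
    induction q using Quotient.inductionOn with | _ a
    induction r using Quotient.inductionOn with | _ b
    obtain ⟨b', hb', hab⟩ := h.sameCycle_inl.1 (faceOf_eq_iff.1 (congrArg Subtype.val hqr))
    exact Quotient.sound (Sum.inl_injective hb' ▸ hab)
  · rintro ⟨f, hf⟩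
    induction f using Quotient.inductionOn with | _ d
    obtain ⟨a, rfl⟩ := hf d rfl
    exact ⟨Quotient.mk _ a, rfl⟩

theorem numAntifaces_eq : Φ.numAntifaces = τ.orbitCount := by
  let g : Quotient (SameCycle.setoid τ) → {f : Φ.Face // Φ.IsAntiface f} :=
    Quotient.lift (fun a => ⟨Φ.faceOf (Sum.inr a), h.isAntiface_inr a⟩) fun a b hab =>
      Subtype.ext (faceOf_eq_iff.2 (h.sameCycle_inr.2 ⟨b, rfl, hab⟩))
  refine (Nat.card_congr (Equiv.ofBijective g ⟨?_, ?_⟩)).symm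
  · intro q r hqr
    induction q using Quotient.inductionOn with | _ a
    induction r using Quotient.inductionOn with | _ b
    obtain ⟨b', hb', hab⟩ := h.sameCycle_inr.1 (faceOf_eq_iff.1 (congrArg Subtype.val hqr))
    exact Quotient.sound (Sum.inr_injective hb' ▸ hab)
  · rintro ⟨f, hf⟩
    induction f using Quotient.inductionOn with | _ d
    obtain ⟨a, rfl⟩ := hf d rfl
    exact ⟨Quotient.mk _ a, rfl⟩

theorem numFaces_eq : Φ.numFaces = σ.orbitCount + τ.orbitCount := by
  have hfin : Finite Φ.Face :=
    inferInstanceAs (Finite (Quotient (SameCycle.setoid Φ.faceNext)))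
  rw [← h.numProfaces_eq, ← h.numAntifaces_eq, numFaces, numProfaces, numAntifaces,
    ← Nat.card_sum]
  have hdis : ∀ f, Φ.IsProface f → ¬ Φ.IsAntiface f := by
    intro f hf hf'
    induction f using Quotient.inductionOn with | _ d
    obtain ⟨a, rfl⟩ := hf d rfl
    obtain ⟨b, hb⟩ := hf' _ rfl
    cases hb
  refine (Nat.card_congr (Equiv.ofBijective (Sum.elim Subtype.val Subtype.val) ⟨?_, ?_⟩)).symm
  · rintro (⟨f, hf⟩ | ⟨f, hf⟩) (⟨f', hf'⟩ | ⟨f', hf'⟩) hff <;>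
      simp only [Sum.elim_inl, Sum.elim_inr] at hff <;> subst hff
    · rfl
    · exact absurd hf' (hdis _ hf)
    · exact absurd hf (hdis _ hf')
    · rfl
  · intro f
    rcases h.isDirected f with hf | hf
    · exact ⟨Sum.inl ⟨f, hf⟩, rfl⟩
    · exact ⟨Sum.inr ⟨f, hf⟩, rfl⟩

end Encodes

/-- The parity of the number of faces of an embedding, from the sign of face tracing. -/
theorem even_numFaces_add [Fintype V] [Fintype A] (Φ : D.OrientedEmbedding)
    (hD : ∀ v, ∃ d, D.inc d = v) :
    Even (Φ.numFaces + Fintype.card A + Fintype.card V) := by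
  classical
  -- Face tracing is the mate involution followed by the inverse rotation. These have one cycle per
  -- arc and one per vertex; the latter needs every vertex to have a half-arc.
  have h1 : Φ.rot.orbitCount = Fintype.card V := by
    rw [← Nat.card_eq_fintype_card]
    let g : Quotient (SameCycle.setoid Φ.rot) → V := Quotient.lift D.inc fun a b hab =>
      SameCycle.rel_of_step (R := fun a b => D.inc a = D.inc b) ⟨fun _ => rfl, Eq.symm, Eq.trans⟩
        (fun a => (Φ.inc_rot a).symm) hab
    refine Nat.card_congr (Equiv.ofBijective g ⟨?_, ?_⟩)
    · intro q r hqr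
      induction q using Quotient.inductionOn with | _ a
      induction r using Quotient.inductionOn with | _ b
      exact Quotient.sound (Φ.sameCycle_rot a b hqr)
    · intro v
      obtain ⟨d, hd⟩ := hD v
      exact ⟨Quotient.mk _ d, hd⟩
  have h2 : orbitCount (Equiv.sumComm A A : Perm (A ⊕ A)) = Fintype.card A := by
    rw [← Nat.card_eq_fintype_card]
    let g : Quotient (SameCycle.setoid (Equiv.sumComm A A : Perm (A ⊕ A))) → A :=
      Quotient.lift (Sum.elim id id) fun a b hab =>
        SameCycle.rel_of_step (R := fun a b => Sum.elim id id a = Sum.elim id id b)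
          ⟨fun _ => rfl, Eq.symm, Eq.trans⟩ (fun a => by cases a <;> rfl) hab
    refine Nat.card_congr (Equiv.ofBijective g ⟨?_, ?_⟩)
    · intro q r hqr
      have key : ∀ d : A ⊕ A, SameCycle (Equiv.sumComm A A : Perm (A ⊕ A)) d
          (Sum.inl (Sum.elim id id d)) := by
        rintro (a | a)
        · exact SameCycle.refl _ _
        · exact sameCycle_apply_self (Equiv.sumComm A A : Perm (A ⊕ A)) _
      induction q using Quotient.inductionOn with | _ a
      induction r using Quotient.inductionOn with | _ b
      refine Quotient.sound ((key a).trans (SameCycle.trans ?_ (key b).symm))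
      rw [show Sum.elim id id a = Sum.elim id id b from hqr]
    · intro a
      exact ⟨Quotient.mk _ (Sum.inl a), rfl⟩
  have h3 : sign Φ.faceNext = sign Φ.rot * sign (Equiv.sumComm A A : Perm (A ⊕ A)) := by
    rw [← sign_symm Φ.rot, ← Perm.sign_mul]
    rfl
  rw [sign_eq_neg_one_pow, sign_eq_neg_one_pow, sign_eq_neg_one_pow, h1, h2,
    show Φ.faceNext.orbitCount = Φ.numFaces from rfl, Fintype.card_sum, ← pow_add] at h3
  have h4 : (-1 : ℤˣ) ^ ((Fintype.card A + Fintype.card A + Φ.numFaces) +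
      (Fintype.card A + Fintype.card A + Fintype.card V +
        (Fintype.card A + Fintype.card A + Fintype.card A))) = 1 := by
    rw [pow_add, h3, ← pow_add]
    exact Even.neg_one_pow ⟨_, rfl⟩
  rw [neg_one_pow_eq_one_iff_even (by decide)] at h4
  rw [Nat.even_iff] at h4 ⊢
  omega

/-- The embedding with given profaces and antifaces. -/
theorem exists_encodes [Finite A] {σ τ : Perm A} (hσ : D.IsTransition σ)
    (hτ : DirectedRotation.Admissible D.head σ τ) :
    ∃ Φ : D.OrientedEmbedding, Φ.Encodes σ τ := by
  -- This is the inverse of the required face tracing followed by the mate map. Two rotation steps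
  -- on incoming half-arcs give `σ⁻¹ * τ`, so admissibility makes the rotation at each vertex a
  -- single cycle.
  let rot : Perm (A ⊕ A) := (Equiv.sumCongr σ.symm τ).trans (Equiv.sumComm A A)
  have rot_inl : ∀ x, rot (Sum.inl x) = Sum.inr (σ.symm x) := fun _ => rfl
  have rot_inr : ∀ x, rot (Sum.inr x) = Sum.inl (τ x) := fun _ => rfl
  have hhead : ∀ x, D.head (σ.symm x) = D.tail x := fun x => by rw [hσ, apply_symm_apply]
  have hinr : ∀ a b, D.head a = D.head b → rot.SameCycle (Sum.inr a) (Sum.inr b) := by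
    intro a b hab
    refine ((hτ a b).2 hab).mem_of_forall_mem
      (p := fun e => rot.SameCycle (Sum.inr a) (Sum.inr e)) (fun e he => ?_) (SameCycle.refl _ _)
    have := sameCycle_apply_right.2 (sameCycle_apply_right.2 he)
    rwa [rot_inr, rot_inl] at this
  have hred : ∀ d : A ⊕ A, ∃ a, D.head a = D.inc d ∧ rot.SameCycle d (Sum.inr a) := by
    rintro (x | x)
    · exact ⟨σ.symm x, hhead x, sameCycle_apply_self rot _⟩
    · exact ⟨x, rfl, SameCycle.refl _ _⟩
  refine ⟨⟨rot, ?_, ?_⟩, fun a => ?_, fun a => ?_⟩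
  · rintro (x | x)
    · exact hhead x
    · rw [rot_inr]
      have := hτ.head_apply x
      exact (hhead (τ x)).symm.trans this
  · intro d e hde
    obtain ⟨a, ha, hda⟩ := hred d
    obtain ⟨b, hb, heb⟩ := hred e
    exact hda.trans ((hinr a b (ha.trans (hde.trans hb.symm))).trans heb.symm)
  · change rot.symm (Sum.inr a) = Sum.inl (σ a)
    rw [symm_apply_eq, rot_inl, symm_apply_apply]
  · change rot.symm (Sum.inl (τ a)) = Sum.inr a
    rw [symm_apply_eq, rot_inr]

theorem genus_le_genus {Φ Ψ : D.OrientedEmbedding} (h : Φ.numFaces ≤ Ψ.numFaces) :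
    Ψ.genus ≤ Φ.genus := by
  have : (Φ.numFaces : ℚ) ≤ Ψ.numFaces := by exact_mod_cast h
  unfold genus
  linarith

end OrientedEmbedding

theorem one_le_alpha [Finite V] {C : Finset (Cycle A)} {a : A} (ha : a ∉ usedArcs C) :
    1 ≤ D.alpha C := by
  have : Nonempty {K : (D.deleteArcs (usedArcs C)).usg.ConnectedComponent //
      ∃ a, (D.deleteArcs (usedArcs C)).usg.connectedComponentMk
        ((D.deleteArcs (usedArcs C)).tail a) = K} := ⟨⟨_, ⟨a, ha⟩, rfl⟩⟩
  exact Nat.card_pos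

end MDigraph

/-! ### The theorem: construction, parity and optimality. -/

theorem corollary4p3 {V A : Type*} [Fintype V] [Fintype A] (D : MDigraph V A)
    [DecidableRel D.usg.Adj]
    (hD : D.IsEulerian)
    (hδ : (4 * (Fintype.card V : ℚ) + 2) / 5 ≤ (D.usg.minDegree : ℚ))
    (C : Finset (Cycle A))
    (hC : ∀ c ∈ C, D.IsCircuit c)
    (hdisj : MDigraph.ArcDisjoint C) :
    ∃ Φ : D.OrientedEmbedding,
      Φ.IsDirected ∧
      (∀ c ∈ C, Φ.BoundsProface c) ∧
      Φ.numProfaces = C.card + D.alpha C ∧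
      (Odd (Fintype.card V + Fintype.card A + C.card + D.alpha C) → Φ.numAntifaces = 1) ∧
      (Even (Fintype.card V + Fintype.card A + C.card + D.alpha C) → Φ.numAntifaces = 2) ∧
      (∀ Ψ : D.OrientedEmbedding, Ψ.IsDirected →
        ((∀ c ∈ C, Ψ.BoundsProface c) ∨ (∀ c ∈ C, Ψ.BoundsAntiface c)) →
        Ψ.genus ≤ Φ.genus) ∧
      (D.alpha C ≤ 1 → ∀ Ψ : D.OrientedEmbedding, Ψ.IsDirected →
        (∀ c ∈ C, Ψ.BoundsProface c ∨ Ψ.BoundsAntiface c) →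
        Ψ.genus ≤ Φ.genus) := by
  classical
  obtain ⟨hconn, hbal⟩ := hD
  have hδ' : 4 * Fintype.card V + 2 ≤ 5 * D.usg.minDegree := by
    have : 4 * (Fintype.card V : ℚ) + 2 ≤ 5 * D.usg.minDegree := by linarith
    exact_mod_cast this
  have hle : ∀ v, D.usg.minDegree ≤ D.usg.degree v := D.usg.minDegree_le_degree
  obtain ⟨v₀⟩ := hconn.nonempty
  have hlt : D.usg.minDegree < Fintype.card V := (hle v₀).trans_lt (D.usg.degree_lt_card_verts v₀)
  have hadj : ∀ v, ∃ w, D.usg.Adj v w := fun v =>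
    (D.usg.degree_pos_iff_exists_adj v).1 (by have := hle v; omega)
  have harc : ∀ u v, D.usg.Adj u v → ∃ a, (D.tail a = u ∧ D.head a = v) ∨
      (D.tail a = v ∧ D.head a = u) := by
    intro u v huv
    obtain ⟨-, ⟨a, ha⟩ | ⟨a, ha⟩⟩ := (SimpleGraph.fromRel_adj _ _ _).1 huv
    · exact ⟨a, Or.inl ha⟩
    · exact ⟨a, Or.inr ha⟩
  have hinc : ∀ v, ∃ d, D.inc d = v := by
    intro v
    obtain ⟨w, hw⟩ := hadj v
    obtain ⟨a, ha | ha⟩ := harc v w hw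
    · exact ⟨Sum.inl a, ha.1⟩
    · exact ⟨Sum.inr a, ha.2⟩
  have hA : Nonempty A := by
    obtain ⟨a | a, -⟩ := hinc v₀ <;> exact ⟨a⟩
  have orbit_pos : ∀ σ : Perm A, 1 ≤ σ.orbitCount := fun σ => by
    have : Nonempty (Quotient (SameCycle.setoid σ)) := ⟨Quotient.mk _ hA.some⟩
    exact Nat.card_pos
  obtain ⟨σ, hσ, hfol, hcount⟩ := MDigraph.exists_isTransition_orbitCount_eq hbal hC hdisj
  -- With `m + 1` the largest number of non-neighbours of a vertex, itself included, the degree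
  -- condition reads 5m + 7 ≤ n.
  obtain ⟨τ, hτ, htwo⟩ := DirectedRotation.exists_admissible_orbitCount_le_two (head := D.head)
    (c := σ) (G := D.usg) (fun u v huv => by
      obtain ⟨a, ha⟩ := harc u v huv
      refine ⟨a, ?_⟩
      have : D.head (σ⁻¹ a) = D.tail a := (hσ _).trans (congrArg D.tail (σ.apply_symm_apply a))
      rwa [this]) hconn (m := Fintype.card V - 1 - D.usg.minDegree) (by omega)
    (fun v => by have := hle v; omega)
  obtain ⟨Φ, hΦ⟩ := MDigraph.OrientedEmbedding.exists_encodes hσ hτ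
  have hτpos := orbit_pos τ
  have hF : Φ.numFaces = C.card + D.alpha C + τ.orbitCount := by rw [hΦ.numFaces_eq, hcount]
  have hpar := Φ.even_numFaces_add hinc
  rw [Nat.even_iff] at hpar
  have homog : ∀ Ψ : D.OrientedEmbedding, Ψ.IsDirected →
      ((∀ c ∈ C, Ψ.BoundsProface c) ∨ (∀ c ∈ C, Ψ.BoundsAntiface c)) → Ψ.genus ≤ Φ.genus := by
    intro Ψ hΨ hb
    obtain ⟨σ', τ', he⟩ := hΨ.exists_encodes
    have hF' := he.numFaces_eq
    have hpar' := Ψ.even_numFaces_add hinc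
    rw [Nat.even_iff] at hpar'
    have h1 := orbit_pos σ'
    have h2 := orbit_pos τ'
    have h3 : C.card + D.alpha C + 1 ≤ Ψ.numFaces := by
      rcases hb with hb | hb
      · have := MDigraph.card_add_alpha_le he.isTransition_left hC hdisj
          fun c hc => he.follows_of_boundsProface (hb c hc)
        omega
      · have := MDigraph.card_add_alpha_le he.isTransition_right hC hdisj
          fun c hc => he.follows_of_boundsAntiface (hb c hc)
        omega
    -- Both face numbers have the same parity, so the lower bound with a single extra face suffices
    -- even when `Φ` has two antifaces.
    exact MDigraph.OrientedEmbedding.genus_le_genus (by omega)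
  refine ⟨Φ, hΦ.isDirected, fun c hc => hΦ.boundsProface (hC c hc) (hfol c hc),
    hΦ.numProfaces_eq.trans hcount, fun hodd => ?_, fun heven => ?_, homog, ?_⟩
  · rw [hΦ.numAntifaces_eq]
    rw [Nat.odd_iff] at hodd
    omega
  · rw [hΦ.numAntifaces_eq]
    rw [Nat.even_iff] at heven
    omega
  · intro hα Ψ hΨ hb
    set P := C.filter fun c => Ψ.BoundsProface c with hP
    set Q := C.filter fun c => ¬ Ψ.BoundsProface c with hQ
    have hPQ : P.card + Q.card = C.card := Finset.card_filter_add_card_filter_not _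
    have hPC : ∀ c ∈ P, c ∈ C ∧ Ψ.BoundsProface c := fun c hc => Finset.mem_filter.1 hc
    have hQC : ∀ c ∈ Q, c ∈ C ∧ ¬ Ψ.BoundsProface c := fun c hc => Finset.mem_filter.1 hc
    rcases P.eq_empty_or_nonempty with hP0 | ⟨p, hp⟩
    · refine homog Ψ hΨ (Or.inr fun c hc => (hb c hc).resolve_left fun h => ?_)
      have : c ∈ P := Finset.mem_filter.2 ⟨hc, h⟩
      rw [hP0] at this
      exact Finset.notMem_empty c this
    rcases Q.eq_empty_or_nonempty with hQ0 | ⟨q, hq⟩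
    · refine homog Ψ hΨ (Or.inl fun c hc => ?_)
      by_contra h
      have : c ∈ Q := Finset.mem_filter.2 ⟨hc, h⟩
      rw [hQ0] at this
      exact Finset.notMem_empty c this
    obtain ⟨σ', τ', he⟩ := hΨ.exists_encodes
    have hF' := he.numFaces_eq
    have hpar' := Ψ.even_numFaces_add hinc
    rw [Nat.even_iff] at hpar'
    have h1 := MDigraph.card_add_alpha_le (C := P) he.isTransition_left (fun c hc => hC c (hPC c hc).1)
      (fun c hc c' hc' => hdisj c (hPC c hc).1 c' (hPC c' hc').1)
      fun c hc => he.follows_of_boundsProface (hPC c hc).2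
    have h2 := MDigraph.card_add_alpha_le (C := Q) he.isTransition_right (fun c hc => hC c (hQC c hc).1)
      (fun c hc c' hc' => hdisj c (hQC c hc).1 c' (hQC c' hc').1)
      fun c hc => he.follows_of_boundsAntiface ((hb c (hQC c hc).1).resolve_left (hQC c hc).2)
    have hne : ∀ c ∈ P, ∀ c' ∈ Q, c ≠ c' := by
      rintro c hc _ hc' rfl
      exact (hQC c hc').2 (hPC c hc).2
    -- Arcs of a circuit on one side are unused by the other side, so each side needs an additional
    -- face. The total is at least |C| + 2, hence at least |C| + α + 1.
    have h3 : 1 ≤ D.alpha P := by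
      obtain ⟨a, ha⟩ := Cycle.exists_mem_of_ne_nil (hC q (hQC q hq).1).1
      refine MDigraph.one_le_alpha (a := a) ?_
      rintro ⟨c, hc, hac⟩
      exact hdisj c (hPC c hc).1 q (hQC q hq).1 (hne c hc q hq) a hac ha
    have h4 : 1 ≤ D.alpha Q := by
      obtain ⟨a, ha⟩ := Cycle.exists_mem_of_ne_nil (hC p (hPC p hp).1).1
      refine MDigraph.one_le_alpha (a := a) ?_
      rintro ⟨c, hc, hac⟩
      exact hdisj p (hPC p hp).1 c (hQC c hc).1 (hne p hp c hc) a ha hac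
    exact MDigraph.OrientedEmbedding.genus_le_genus (by omega)
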